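/- Let $1\le p<2$. There is a constant $\kappa_p>1$, depending only on $p$, such that the following holds. Let $d$ be a dimension, let $(\varepsilon_i)_{i\in\mathbb Z}$ be an i.i.d. sequence of random variables with values in $\mathbb R^d$ (on any probability space), and let $h\colon\mathbb R^d\times\mathbb R^d\to\mathbb R$ be a measurable function such that $\mathbb E|h(\varepsilon_0,\varepsilon_1)|^p<\infty$ and $\mathbb E\,h(\varepsilon_0,\varepsilon_1)=0$. Put $$U_n^{\mathrm{ind}}:=\sum_{1\le i<j\le n}h(\varepsilon_i,\varepsilon_j),\qquad M_p:=\sup_{n\ge 1}\frac{1}{n^{1+1/p}}\,\bigl|U_n^{\mathrm{ind}}\bigr|\in[0,\infty].$$ Then: 1. $n^{-1-1/p}\,\bigl|U_n^{\mathrm{ind}}\bigr|\to 0$ almost surely as $n\to\infty$; 2. for every $x>0$, $$x^p\,\mathbb P\{M_p>x\}\le\kappa_p\,\mathbb E|h(\varepsilon_0,\varepsilon_1)|^p .$$ -/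

import Mathlib

open MeasureTheory ProbabilityTheory Filter Topology

/-- The U-statistic `∑_{1 ≤ i < j ≤ n} h (ε i) (ε j)` of order two with kernel `h`
and data `(ε i)`, `i ∈ ℤ`. -/
def UInd {Ω E : Type*} (h : E → E → ℝ) (ε : ℤ → Ω → E) (n : ℕ) (ω : Ω) : ℝ :=
  ∑ j ∈ Finset.Icc 1 n, ∑ i ∈ Finset.Ico 1 j, h (ε (i : ℤ) ω) (ε (j : ℤ) ω)

/-- The maximal function `sup_{n ≥ 1} n^{-(1 + 1/p)} |U_n|`, with values in `[0, ∞]`. -/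
noncomputable def maxUInd {Ω E : Type*} (p : ℝ) (h : E → E → ℝ) (ε : ℤ → Ω → E) (ω : Ω) :
    ENNReal :=
  ⨆ (n : ℕ) (_ : 1 ≤ n), ENNReal.ofReal (1 / (n : ℝ) ^ (1 + 1 / p) * |UInd h ε n ω|)

/-- `(ε i)`, `i ∈ ℤ`, is an independent identically distributed sequence of random
variables with values in `E`. -/
structure IsIID {Ω E : Type*} [MeasurableSpace Ω] [MeasurableSpace E]
    (ε : ℤ → Ω → E) (P : Measure Ω) : Prop where
  measurable : ∀ i, Measurable (ε i)
  indep : iIndepFun ε P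
  identDistrib : ∀ i, IdentDistrib (ε i) (ε 0) P P

/-! Write `r = 1/p`, `θ = E|k|^p`, and let `B y` be the `p`-th absolute moment of the section `k (·,
y)`. After dividing the kernel by `x`, it suffices to bound by a multiple of `θ` the probability
that `|U_n| > n^(1+r)` for some `n ≤ N`, uniformly in `N`.

Group the pairs by their larger index `j`, and in column `j` keep the kernel only where `|k|^p ≤ j²`
and `B ≤ j`. Since `∑ j 1{j² < u} ≤ u` and `∑ 1{j < u} ≤ u`, truncation acts somewhere with
probability at most `2θ`. Subtracting from each truncated column its mean given the past leaves a
martingale. A column has second moment at most `j E k_j² + j² E(∫ k_j(x,·) dx)²`, and the section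
mean is at most `B^r`. Weighted by `j^(-2-2r)`, these sum to a multiple of `θ`, because `2r > 1`; a
Hájek–Rényi inequality then controls the martingale.

The compensator is the sum over `i < j` of `b_j(ξ_i)`, with `b_j(x) = ∫ k_j(x,y) dy`. For `p > 1`,
replacing `b_j` by `a(x) = ∫ k(x,y) dy` costs an error that is summable in `L¹`. What remains are
partial sums of the centred i.i.d. variables `a(ξ_i)`, to which the Marcinkiewicz–Zygmund weak type
inequality applies, itself proved by the same truncation scheme in one variable. For `p = 1` no
cancellation is needed: the domination `|b_j(x)| ≤ ∫ |k(x,y)| dy` suffices. The kernel need not be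
symmetric.

The almost sure limit follows by density. A bounded centred kernel satisfies the maximal inequality
with an exponent `s > p`, so `U_n = O(n^(1+1/s)) = o(n^(1+1/p))`. A general kernel is approximated
in `L^p` by bounded centred ones, and the maximal inequality controls the error uniformly in `n`.

The argument rests on `exists_linear_weak_type`, `exists_drift_weak_type`, `exists_kernel_weak_type`
and `ae_tendsto_kernel`. -/

/-! ### Truncated power series and summation by parts -/

theorem rpow_neg_sub_rpow_neg_ge {β : ℝ} (hβ : 0 < β) {j : ℝ} (hj : 1 ≤ j) :
    β / (β + 2) * j ^ (-(β + 1)) ≤ j ^ (-β) - (j + 1) ^ (-β) := by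
  have hj0 : 0 < j := by linarith
  -- From `log (1 + 1/j) ≥ 1/(2j)` and `exp x ≥ 1 + x`, the relative decrement is at least `β / (2j
  -- + β)`; `j ≥ 1` bounds this denominator by `(β + 2) j`.
  set x : ℝ := β / (2 * j) with hx
  have hx0 : 0 < x := by positivity
  have hlog : 1 / (2 * j) ≤ Real.log (1 + 1 / j) := by
    have h1 := Real.one_sub_inv_le_log_of_pos (x := 1 + 1 / j) (by positivity)
    have h2 : 1 - (1 + 1 / j)⁻¹ = 1 / (j + 1) := by field_simp; ring
    rw [h2] at h1
    refine le_trans ?_ h1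
    apply one_div_le_one_div_of_le <;> linarith
  have hexp : (1 + 1 / j) ^ (-β) ≤ 1 / (1 + x) := by
    rw [Real.rpow_def_of_pos (by positivity)]
    have h3 : Real.log (1 + 1 / j) * -β ≤ -x := by
      have : x = 1 / (2 * j) * β := by rw [hx]; ring
      nlinarith
    calc _ ≤ Real.exp (-x) := Real.exp_le_exp.mpr h3
      _ = 1 / Real.exp x := by rw [Real.exp_neg, one_div]
      _ ≤ 1 / (1 + x) := by
        apply one_div_le_one_div_of_le (by positivity)
        linarith [Real.add_one_le_exp x]
  have hfac : (j + 1) ^ (-β) = j ^ (-β) * (1 + 1 / j) ^ (-β) := by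
    rw [← Real.mul_rpow hj0.le (by positivity)]
    congr 1; field_simp
  have hfac2 : j ^ (-(β + 1)) = j ^ (-β) * (1 / j) := by
    rw [neg_add, Real.rpow_add hj0, Real.rpow_neg_one, one_div]
  rw [hfac, hfac2]
  have hp : 0 < j ^ (-β) := Real.rpow_pos_of_pos hj0 _
  have key : β / (β + 2) * (1 / j) ≤ 1 - 1 / (1 + x) := by
    have : 1 - 1 / (1 + x) = β / (2 * j + β) := by rw [hx]; field_simp; ring
    rw [this, div_mul_div_comm, mul_one]
    apply div_le_div_of_nonneg_left hβ.le (by positivity)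
    nlinarith
  nlinarith

theorem sum_rpow_neg_tail_le {β : ℝ} (hβ : 0 < β) {s : ℝ} (hs : 1 ≤ s) (N : ℕ) :
    ∑ j ∈ Finset.Icc 1 N, (if s ≤ (j : ℝ) then (j : ℝ) ^ (-(β + 1)) else 0)
      ≤ (β + 2) / β * s ^ (-β) := by
  -- The subtracted term makes the induction telescope; the maximum covers the range where no term
  -- has yet reached `s`.
  have claim : ∑ j ∈ Finset.Icc 1 N, (if s ≤ (j : ℝ) then (j : ℝ) ^ (-(β + 1)) else 0)
      ≤ (β + 2) / β * (s ^ (-β) - (max s (N + 1)) ^ (-β)) := by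
    induction N with
    | zero => simp [hs]
    | succ N ih =>
      rw [Finset.sum_Icc_succ_top (by omega)]
      push_cast
      split_ifs with hc
      · have h1 : max s ((N : ℝ) + 1) = N + 1 := max_eq_right hc
        have h2 : max s ((N : ℝ) + 1 + 1) = N + 1 + 1 := max_eq_right (by linarith)
        rw [h1] at ih
        rw [h2]
        have h3 := rpow_neg_sub_rpow_neg_ge hβ (j := (N : ℝ) + 1) (by linarith)
        have h4 : ((N : ℝ) + 1) ^ (-(β + 1)) ≤
            (β + 2) / β * (((N : ℝ) + 1) ^ (-β) - ((N : ℝ) + 1 + 1) ^ (-β)) := by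
          calc _ = (β + 2) / β * (β / (β + 2) * ((N : ℝ) + 1) ^ (-(β + 1))) := by field_simp
            _ ≤ _ := by gcongr
        linarith
      · refine le_trans (by simpa using ih) ?_
        have : (max s ((N : ℝ) + 1 + 1)) ^ (-β) ≤ (max s ((N : ℝ) + 1)) ^ (-β) :=
          Real.rpow_le_rpow_of_nonpos (lt_of_lt_of_le (by linarith) (le_max_left _ _))
            (max_le_max le_rfl (by linarith)) (by linarith)
        gcongr
  refine claim.trans ?_
  gcongr
  have : 0 ≤ (max s ((N : ℝ) + 1)) ^ (-β) :=
    Real.rpow_nonneg (le_trans (by linarith) (le_max_left _ _)) _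
  linarith

theorem sum_rpow_neg_head_le {γ : ℝ} (hγ : 0 < γ) (hγ1 : γ ≤ 1) {s : ℝ} (hs : 0 ≤ s) (N : ℕ) :
    ∑ j ∈ Finset.Icc 1 N, (if (j : ℝ) < s then (j : ℝ) ^ (γ - 1) else 0) ≤ 1 / γ * s ^ γ := by
  have claim : ∑ j ∈ Finset.Icc 1 N, (if (j : ℝ) < s then (j : ℝ) ^ (γ - 1) else 0)
      ≤ 1 / γ * (min s N) ^ γ := by
    induction N with
    | zero => simp [hs, Real.zero_rpow hγ.ne']
    | succ N ih =>
      rw [Finset.sum_Icc_succ_top (by omega)]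
      push_cast
      have hN : (0 : ℝ) < N + 1 := by positivity
      split_ifs with hc
      · rw [min_eq_right (by linarith : (N : ℝ) ≤ s)] at ih
        rw [min_eq_right hc.le]
        -- Bernoulli's inequality for the concave power `γ ≤ 1` gives `N^γ ≤ (N+1)^γ - γ
        -- (N+1)^(γ-1)`, the telescoping step.
        have h1 := rpow_one_add_le_one_add_mul_self (s := -1 / ((N : ℝ) + 1)) (p := γ)
          (by rw [le_div_iff₀ hN]; linarith) hγ.le hγ1
        have h2 : (N : ℝ) ^ γ = ((N : ℝ) + 1) ^ γ * (1 + -1 / ((N : ℝ) + 1)) ^ γ := by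
          rw [← Real.mul_rpow hN.le (by
            rw [show 1 + -1 / ((N : ℝ) + 1) = N / (N + 1) by field_simp; ring]; positivity)]
          congr 1; field_simp; ring
        have h3 : ((N : ℝ) + 1) ^ (γ - 1) = ((N : ℝ) + 1) ^ γ * (1 / ((N : ℝ) + 1)) := by
          rw [Real.rpow_sub_one hN.ne']; ring
        have hp : 0 < ((N : ℝ) + 1) ^ γ := Real.rpow_pos_of_pos hN _
        have h4 : (N : ℝ) ^ γ ≤ ((N : ℝ) + 1) ^ γ - γ * ((N : ℝ) + 1) ^ (γ - 1) := by
          rw [h2, h3]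
          calc _ ≤ ((N : ℝ) + 1) ^ γ * (1 + γ * (-1 / ((N : ℝ) + 1))) := by gcongr
            _ = _ := by ring
        have h5 : 1 / γ * (N : ℝ) ^ γ ≤ 1 / γ * ((N : ℝ) + 1) ^ γ - ((N : ℝ) + 1) ^ (γ - 1) := by
          calc _ ≤ 1 / γ * (((N : ℝ) + 1) ^ γ - γ * ((N : ℝ) + 1) ^ (γ - 1)) := by gcongr
            _ = _ := by field_simp
        linarith
      · rw [add_zero]
        refine ih.trans ?_
        gcongr
        linarith
  refine claim.trans ?_
  gcongr
  exact min_le_left _ _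

theorem sum_indicator_lt_le {u : ℝ} (hu : 0 ≤ u) (N : ℕ) :
    ∑ j ∈ Finset.Icc 1 N, (if (j : ℝ) < u then (1 : ℝ) else 0) ≤ u := by
  simpa using sum_rpow_neg_head_le (γ := 1) one_pos le_rfl hu N

/-- The weight `j` bounds the number of pairs in column `j`, so this is the union bound over all
pairs for truncation at level `j²`. -/
theorem sum_mul_indicator_sq_lt_le {u : ℝ} (hu : 0 ≤ u) (N : ℕ) :
    ∑ j ∈ Finset.Icc 1 N, (if (j : ℝ) ^ 2 < u then (j : ℝ) else 0) ≤ u := by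
  have claim : ∑ j ∈ Finset.Icc 1 N, (if (j : ℝ) ^ 2 < u then (j : ℝ) else 0)
      ≤ min u ((N : ℝ) ^ 2) := by
    induction N with
    | zero => simp [hu]
    | succ N ih =>
      rw [Finset.sum_Icc_succ_top (by omega)]
      push_cast
      have hN : (0 : ℝ) ≤ N := by positivity
      split_ifs with hc
      · rw [min_eq_right hc.le]
        have := ih.trans (min_le_right _ _)
        nlinarith
      · rw [add_zero]
        refine ih.trans (min_le_min le_rfl ?_)
        gcongr; linarith
  exact claim.trans (min_le_left _ _)

/-- Second moment series for one-dimensional truncation at level `j`. -/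
theorem sum_truncated_sq_le {r : ℝ} (hr : 1 / 2 < r) {u : ℝ} (hu : 0 ≤ u) (N : ℕ) :
    ∑ j ∈ Finset.Icc 1 N, (if u ≤ (j : ℝ) then (j : ℝ) ^ (-(2 * r)) * u ^ (2 * r) else 0)
      ≤ (2 * r + 1) / (2 * r - 1) * u := by
  have hβ : 0 < 2 * r - 1 := by linarith
  have h0 := sum_rpow_neg_tail_le hβ (le_max_right u 1) N
  have e1 : -(2 * r - 1 + 1) = -(2 * r) := by ring
  rw [e1, show 2 * r - 1 + 2 = 2 * r + 1 by ring] at h0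
  have h1 : ∑ j ∈ Finset.Icc 1 N, (if u ≤ (j : ℝ) then (j : ℝ) ^ (-(2 * r)) * u ^ (2 * r) else 0)
      = (∑ j ∈ Finset.Icc 1 N, (if max u 1 ≤ (j : ℝ) then (j : ℝ) ^ (-(2 * r)) else 0))
        * u ^ (2 * r) := by
    rw [Finset.sum_mul]
    refine Finset.sum_congr rfl fun j hj => ?_
    have : (1 : ℝ) ≤ j := by exact_mod_cast (Finset.mem_Icc.mp hj).1
    simp [this, ite_mul]
  rw [h1]
  have hC : 0 ≤ (2 * r + 1) / (2 * r - 1) := div_nonneg (by linarith) hβ.le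
  refine (mul_le_mul_of_nonneg_right h0 (Real.rpow_nonneg hu _)).trans ?_
  rw [mul_assoc]
  refine mul_le_mul_of_nonneg_left ?_ hC
  -- For `u ≥ 1` the tail decays as `u^(1-2r)`, exactly compensating `u^(2r)`. For `u ≤ 1` every
  -- index contributes, and `u^(2r) ≤ u`.
  rcases le_total 1 u with h | h
  · rw [max_eq_left h, ← Real.rpow_add (by linarith)]
    apply le_of_eq
    rw [show -(2 * r - 1) + 2 * r = 1 by ring, Real.rpow_one]
  · rw [max_eq_right h, Real.one_rpow, one_mul]
    exact Real.rpow_le_self_of_le_one hu h (by linarith)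

/-- Second moment series for two-dimensional truncation at level `j ^ 2`. -/
theorem sum_truncated_sq_le' {r : ℝ} (hr : 1 / 2 < r) (hr1 : r ≤ 1) {u : ℝ} (hu : 0 ≤ u) (N : ℕ) :
    ∑ j ∈ Finset.Icc 1 N,
      (if u ≤ (j : ℝ) ^ 2 then (j : ℝ) ^ (-(2 * r + 1)) * u ^ (2 * r) else 0)
      ≤ (2 * r + 2) / (2 * r) * u := by
  have hβ : 0 < 2 * r := by linarith
  set v := Real.sqrt u with hv
  have hv0 : 0 ≤ v := Real.sqrt_nonneg _
  have huv : u = v ^ (2 : ℝ) := by rw [Real.rpow_two, hv, Real.sq_sqrt hu]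
  have h0 := sum_rpow_neg_tail_le hβ (le_max_right v 1) N
  have h1 : ∑ j ∈ Finset.Icc 1 N,
      (if u ≤ (j : ℝ) ^ 2 then (j : ℝ) ^ (-(2 * r + 1)) * u ^ (2 * r) else 0)
      = (∑ j ∈ Finset.Icc 1 N, (if max v 1 ≤ (j : ℝ) then (j : ℝ) ^ (-(2 * r + 1)) else 0))
        * u ^ (2 * r) := by
    rw [Finset.sum_mul]
    refine Finset.sum_congr rfl fun j hj => ?_
    have h1 : (1 : ℝ) ≤ j := by exact_mod_cast (Finset.mem_Icc.mp hj).1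
    have h2 : u ≤ (j : ℝ) ^ 2 ↔ v ≤ j := by
      rw [hv, Real.sqrt_le_left (by linarith)]
    simp [h1, h2, ite_mul]
  rw [h1]
  refine (mul_le_mul_of_nonneg_right h0 (Real.rpow_nonneg hu _)).trans ?_
  rw [mul_assoc]
  refine mul_le_mul_of_nonneg_left ?_ (by positivity)
  rw [huv, ← Real.rpow_mul hv0]
  -- In terms of `v = √u` the product is `v^(2r) ≤ v²` for `v ≥ 1`, by `r ≤ 1`, and `v^(4r) ≤ v²`
  -- for `v ≤ 1`, by `r > 1/2`.
  rcases le_total 1 v with h | h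
  · rw [max_eq_left h, ← Real.rpow_add (by linarith)]
    exact Real.rpow_le_rpow_of_exponent_le h (by linarith)
  · rw [max_eq_right h, Real.one_rpow, one_mul]
    rcases hv0.eq_or_lt with h0 | h0
    · rw [← h0, Real.zero_rpow (by linarith), Real.zero_rpow (by norm_num)]
    · exact Real.rpow_le_rpow_of_exponent_ge h0 h (by linarith)

theorem sum_tail_first_moment_le {r : ℝ} (hr0 : 0 ≤ r) (hr1 : r < 1) {u : ℝ} (hu : 0 ≤ u) (N : ℕ) :
    ∑ j ∈ Finset.Icc 1 N, (if (j : ℝ) < u then (j : ℝ) ^ (-r) * u ^ r else 0)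
      ≤ 1 / (1 - r) * u := by
  have h0 := sum_rpow_neg_head_le (γ := 1 - r) (by linarith) (by linarith) hu N
  rw [show 1 - r - 1 = -r by ring] at h0
  have h1 : ∑ j ∈ Finset.Icc 1 N, (if (j : ℝ) < u then (j : ℝ) ^ (-r) * u ^ r else 0)
      = (∑ j ∈ Finset.Icc 1 N, (if (j : ℝ) < u then (j : ℝ) ^ (-r) else 0)) * u ^ r := by
    rw [Finset.sum_mul]
    exact Finset.sum_congr rfl fun j _ => by simp [ite_mul]
  rw [h1]
  refine (mul_le_mul_of_nonneg_right h0 (Real.rpow_nonneg hu _)).trans ?_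
  rw [mul_assoc, ← Real.rpow_add' hu (by simp)]
  simp

theorem sum_tail_first_moment_le' {r : ℝ} (hr0 : 0 ≤ r) (hr1 : r < 1) {u : ℝ} (hu : 0 ≤ u)
    (N : ℕ) :
    ∑ j ∈ Finset.Icc 1 N, (if (j : ℝ) ^ 2 < u then (j : ℝ) ^ (-r) * u ^ r else 0)
      ≤ 1 / (1 - r) * u := by
  refine le_trans (Finset.sum_le_sum fun j hj => ?_) (sum_tail_first_moment_le hr0 hr1 hu N)
  have h1 : (1 : ℝ) ≤ j := by exact_mod_cast (Finset.mem_Icc.mp hj).1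
  have h2 : 0 ≤ (j : ℝ) ^ (-r) * u ^ r := by positivity
  split_ifs with ha hb hb
  · exact le_rfl
  · exact absurd (lt_of_le_of_lt (by nlinarith) ha) hb
  · exact h2
  · exact le_rfl

/-- Summation by parts: bounds on weighted partial sums control the partial sums. -/
theorem abs_sum_le_of_weighted_sums_le {c d : ℕ → ℝ} (hc0 : 0 ≤ c 0) (hc : Monotone c)
    (hcpos : ∀ j, 1 ≤ j → 0 < c j) {t : ℝ} (n : ℕ)
    (hM : ∀ k ≤ n, |∑ j ∈ Finset.Icc 1 k, (c j)⁻¹ * d j| ≤ t) :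
    |∑ j ∈ Finset.Icc 1 n, d j| ≤ 2 * c n * t := by
  have ht : 0 ≤ t := (abs_nonneg _).trans (hM n le_rfl)
  have hcn : ∀ n, 0 ≤ c n := fun n => hc0.trans (hc (Nat.zero_le n))
  -- The difference is minus the sum of `(c (k+1) - c k)` times the weighted partial sums, and the
  -- increments of `c` add up to at most `c n`.
  have claim : |∑ j ∈ Finset.Icc 1 n, d j - c n * ∑ j ∈ Finset.Icc 1 n, (c j)⁻¹ * d j|
      ≤ c n * t := by
    induction n with
    | zero => simpa using mul_nonneg (hcn 0) ht
    | succ n ih =>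
      have ih := ih fun k hk => hM k (by omega)
      rw [Finset.sum_Icc_succ_top (by omega), Finset.sum_Icc_succ_top (by omega)]
      have hcp := hcpos (n + 1) (by omega)
      set S := ∑ j ∈ Finset.Icc 1 n, d j
      set M := ∑ j ∈ Finset.Icc 1 n, (c j)⁻¹ * d j with hMdef
      have e : S + d (n + 1) - c (n + 1) * (M + (c (n + 1))⁻¹ * d (n + 1))
          = (S - c n * M) - (c (n + 1) - c n) * M := by
        field_simp; ring
      rw [e]
      have h1 : |(c (n + 1) - c n) * M| ≤ (c (n + 1) - c n) * t := by
        rw [abs_mul, abs_of_nonneg (sub_nonneg.mpr (hc (Nat.le_succ n)))]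
        exact mul_le_mul_of_nonneg_left (hM n (by omega)) (sub_nonneg.mpr (hc (Nat.le_succ n)))
      calc _ ≤ |S - c n * M| + |(c (n + 1) - c n) * M| := abs_sub _ _
        _ ≤ _ := by linarith
  have h2 : |c n * ∑ j ∈ Finset.Icc 1 n, (c j)⁻¹ * d j| ≤ c n * t := by
    rw [abs_mul, abs_of_nonneg (hcn n)]
    exact mul_le_mul_of_nonneg_left (hM n le_rfl) (hcn n)
  have h3 := abs_sub_abs_le_abs_sub (∑ j ∈ Finset.Icc 1 n, d j)
    (c n * ∑ j ∈ Finset.Icc 1 n, (c j)⁻¹ * d j)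
  linarith

/-! ### Maximal inequalities for bounded martingale differences -/

section Doob

variable {Ω : Type*} {m : MeasurableSpace Ω} {P : Measure Ω}

theorem integrable_of_abs_le [IsFiniteMeasure P] {f : Ω → ℝ} (hf : Measurable f) {K : ℝ} (hK : ∀ ω, |f ω| ≤ K) :
    Integrable f P :=
  Integrable.of_bound hf.aestronglyMeasurable K (ae_of_all _ fun ω => by simpa using hK ω)

/-- A sequence of bounded random variables, adapted to a filtration, each orthogonal to the past. -/
structure IsBoundedMartingaleDiff (𝒢 : Filtration ℕ m) (P : Measure Ω) (d : ℕ → Ω → ℝ) : Prop where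
  meas : ∀ j, Measurable[𝒢 j] (d j)
  bound : ∀ j, ∃ K, ∀ ω, |d j ω| ≤ K
  orth : ∀ j, ∀ Z : Ω → ℝ, Measurable[𝒢 j] Z → (∃ K, ∀ ω, |Z ω| ≤ K) →
    ∫ ω, Z ω * d (j + 1) ω ∂P = 0

namespace IsBoundedMartingaleDiff

variable {𝒢 : Filtration ℕ m} {d : ℕ → Ω → ℝ}

theorem const_mul (hd : IsBoundedMartingaleDiff 𝒢 P d) (c : ℕ → ℝ) :
    IsBoundedMartingaleDiff 𝒢 P (fun j ω => c j * d j ω) where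
  meas j := (hd.meas j).const_mul _
  bound j := by
    obtain ⟨K, hK⟩ := hd.bound j
    refine ⟨|c j| * K, fun ω => ?_⟩
    rw [abs_mul]
    exact mul_le_mul_of_nonneg_left (hK ω) (abs_nonneg _)
  orth j Z hZ hb := by
    have := hd.orth j Z hZ hb
    calc _ = ∫ ω, c (j + 1) * (Z ω * d (j + 1) ω) ∂P := by congr 1; ext ω; ring
      _ = 0 := by rw [integral_const_mul, this, mul_zero]

theorem measurable_sum (hd : IsBoundedMartingaleDiff 𝒢 P d) (n : ℕ) :
    Measurable[𝒢 n] (fun ω => ∑ j ∈ Finset.Icc 1 n, d j ω) :=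
  Finset.measurable_fun_sum _ fun j hj =>
    (hd.meas j).mono (𝒢.mono (Finset.mem_Icc.mp hj).2) le_rfl

theorem bound_sum (hd : IsBoundedMartingaleDiff 𝒢 P d) (n : ℕ) :
    ∃ K, ∀ ω, |∑ j ∈ Finset.Icc 1 n, d j ω| ≤ K := by
  choose K hK using hd.bound
  exact ⟨∑ j ∈ Finset.Icc 1 n, K j, fun ω =>
    (Finset.abs_sum_le_sum_abs _ _).trans (Finset.sum_le_sum fun j _ => hK j ω)⟩

theorem integrable_mul [IsFiniteMeasure P] {f g : Ω → ℝ} (hf : Measurable f) (hg : Measurable g)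
    (hfb : ∃ K, ∀ ω, |f ω| ≤ K) (hgb : ∃ K, ∀ ω, |g ω| ≤ K) :
    Integrable (fun ω => f ω * g ω) P := by
  obtain ⟨K, hK⟩ := hfb
  obtain ⟨K', hK'⟩ := hgb
  refine integrable_of_abs_le (hf.mul hg) (K := K * K') fun ω => ?_
  simp only [abs_mul]
  exact mul_le_mul (hK ω) (hK' ω) (abs_nonneg _) ((abs_nonneg _).trans (hK ω))

/-- Expanding the square of the next partial sum, the cross term integrates to zero over any past
event `s`: orthogonality is tested against the partial sum times the indicator of `s`. The remaining
increment is a square. -/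
theorem submartingale_sq [IsFiniteMeasure P]
    (hd : IsBoundedMartingaleDiff 𝒢 P d) :
    Submartingale (fun n ω => (∑ j ∈ Finset.Icc 1 n, d j ω) ^ 2) 𝒢 P := by
  have hint : ∀ n, Integrable (fun ω => (∑ j ∈ Finset.Icc 1 n, d j ω) ^ 2) P := fun n => by
    have := (hd.measurable_sum n).mono (𝒢.le n) le_rfl
    simpa only [sq] using integrable_mul this this (hd.bound_sum n) (hd.bound_sum n)
  refine submartingale_of_setIntegral_le_succ
    (fun n => ((hd.measurable_sum n).pow_const 2).stronglyMeasurable) hint fun n s hs => ?_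
  have hdm : Measurable (d (n + 1)) := (hd.meas (n + 1)).mono (𝒢.le _) le_rfl
  have hsm : MeasurableSet s := 𝒢.le n s hs
  have hZm : Measurable[𝒢 n] (s.indicator fun ω => ∑ j ∈ Finset.Icc 1 n, d j ω) :=
    (hd.measurable_sum n).indicator hs
  have hZb : ∃ K, ∀ ω, |s.indicator (fun ω => ∑ j ∈ Finset.Icc 1 n, d j ω) ω| ≤ K := by
    obtain ⟨K, hK⟩ := hd.bound_sum n
    refine ⟨K, fun ω => ?_⟩
    by_cases h : ω ∈ s
    · simpa [h] using hK ω
    · simpa [h] using (abs_nonneg _).trans (hK ω)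
  have horth := hd.orth n _ hZm hZb
  have hcross : ∫ ω in s, (∑ j ∈ Finset.Icc 1 n, d j ω) * d (n + 1) ω ∂P = 0 := by
    rw [← integral_indicator hsm, ← horth]
    congr 1; ext ω
    by_cases h : ω ∈ s <;> simp [h]
  have hMm := (hd.measurable_sum n).mono (𝒢.le n) le_rfl
  have i1 := (integrable_mul (P := P) hMm hdm (hd.bound_sum n) (hd.bound (n + 1))).integrableOn
    (s := s)
  have i2 := (integrable_mul (P := P) hdm hdm (hd.bound (n + 1)) (hd.bound (n + 1))).integrableOn
    (s := s)
  have i3 : IntegrableOn (fun ω => 2 * ((∑ j ∈ Finset.Icc 1 n, d j ω) * d (n + 1) ω)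
      + d (n + 1) ω * d (n + 1) ω) s P := (i1.const_mul 2).add i2
  have e : ∀ ω, (∑ j ∈ Finset.Icc 1 (n + 1), d j ω) ^ 2 = (∑ j ∈ Finset.Icc 1 n, d j ω) ^ 2
      + (2 * ((∑ j ∈ Finset.Icc 1 n, d j ω) * d (n + 1) ω) + d (n + 1) ω * d (n + 1) ω) := by
    intro ω
    rw [Finset.sum_Icc_succ_top (by omega)]; ring
  simp_rw [e]
  rw [integral_add (hint n).integrableOn i3,
    integral_add (i1.const_mul 2) i2, integral_const_mul, hcross]
  have : 0 ≤ ∫ ω in s, d (n + 1) ω * d (n + 1) ω ∂P :=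
    integral_nonneg fun ω => mul_self_nonneg _
  linarith

theorem integral_sum_sq [IsFiniteMeasure P] (hd : IsBoundedMartingaleDiff 𝒢 P d) (n : ℕ) :
    ∫ ω, (∑ j ∈ Finset.Icc 1 n, d j ω) ^ 2 ∂P = ∑ j ∈ Finset.Icc 1 n, ∫ ω, d j ω ^ 2 ∂P := by
  induction n with
  | zero => simp
  | succ n ih =>
    have hdm : Measurable (d (n + 1)) := (hd.meas (n + 1)).mono (𝒢.le _) le_rfl
    have hMm := (hd.measurable_sum n).mono (𝒢.le n) le_rfl
    have i0 := integrable_mul (P := P) hMm hMm (hd.bound_sum n) (hd.bound_sum n)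
    have i1 := integrable_mul (P := P) hMm hdm (hd.bound_sum n) (hd.bound (n + 1))
    have i2 := integrable_mul (P := P) hdm hdm (hd.bound (n + 1)) (hd.bound (n + 1))
    simp_rw [← sq] at i0 i2
    have i3 : Integrable (fun ω => 2 * ((∑ j ∈ Finset.Icc 1 n, d j ω) * d (n + 1) ω)
        + d (n + 1) ω ^ 2) P := (i1.const_mul 2).add i2
    have e : ∀ ω, (∑ j ∈ Finset.Icc 1 (n + 1), d j ω) ^ 2 = (∑ j ∈ Finset.Icc 1 n, d j ω) ^ 2
        + (2 * ((∑ j ∈ Finset.Icc 1 n, d j ω) * d (n + 1) ω) + d (n + 1) ω ^ 2) := by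
      intro ω
      rw [Finset.sum_Icc_succ_top (by omega)]; ring
    simp_rw [e]
    rw [integral_add i0 i3, integral_add (i1.const_mul 2) i2,
      integral_const_mul, hd.orth n _ (hd.measurable_sum n) (hd.bound_sum n), ih,
      Finset.sum_Icc_succ_top (by omega)]
    ring

/-- Kolmogorov's maximal inequality for martingale differences. -/
theorem measure_exists_le [IsFiniteMeasure P] (hd : IsBoundedMartingaleDiff 𝒢 P d) (N : ℕ) {t : ℝ} (ht : 0 < t) :
    P.real {ω | ∃ n ≤ N, t ≤ |∑ j ∈ Finset.Icc 1 n, d j ω|}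
      ≤ (∑ j ∈ Finset.Icc 1 N, ∫ ω, d j ω ^ 2 ∂P) / t ^ 2 := by
  have hmax := maximal_ineq hd.submartingale_sq (fun n ω => sq_nonneg _)
    (ε := ⟨t ^ 2, by positivity⟩) N
  set A := {ω | ((⟨t ^ 2, by positivity⟩ : NNReal) : ℝ) ≤
    (Finset.range (N + 1)).sup' Finset.nonempty_range_add_one
      fun k => (∑ j ∈ Finset.Icc 1 k, d j ω) ^ 2} with hA
  have hsub : {ω | ∃ n ≤ N, t ≤ |∑ j ∈ Finset.Icc 1 n, d j ω|} ⊆ A := by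
    rintro ω ⟨n, hn, h⟩
    rw [hA, Set.mem_ofPred_eq, Finset.le_sup'_iff]
    refine ⟨n, by simpa using Nat.lt_succ_of_le hn, ?_⟩
    rw [← sq_abs (∑ j ∈ Finset.Icc 1 n, d j ω)]
    exact pow_le_pow_left₀ ht.le h 2
  have hint : Integrable (fun ω => (∑ j ∈ Finset.Icc 1 N, d j ω) ^ 2) P :=
    hd.submartingale_sq.integrable N
  have h1 : ∫ ω in A, (∑ j ∈ Finset.Icc 1 N, d j ω) ^ 2 ∂P
      ≤ ∑ j ∈ Finset.Icc 1 N, ∫ ω, d j ω ^ 2 ∂P := by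
    rw [← hd.integral_sum_sq N]
    exact setIntegral_le_integral hint (ae_of_all _ fun ω => sq_nonneg _)
  have h2 := ENNReal.toReal_mono ENNReal.ofReal_ne_top hmax
  rw [ENNReal.toReal_mul, ENNReal.toReal_ofReal (integral_nonneg fun ω => sq_nonneg _)] at h2
  rw [le_div_iff₀ (by positivity), mul_comm]
  calc _ ≤ t ^ 2 * P.real A :=
        mul_le_mul_of_nonneg_left (measureReal_mono hsub) (by positivity)
    _ ≤ _ := h2.trans h1

/-- A Hájek–Rényi type maximal inequality. -/
theorem measure_exists_weighted_le [IsFiniteMeasure P]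
    (hd : IsBoundedMartingaleDiff 𝒢 P d) {c : ℕ → ℝ} (hc0 : 0 ≤ c 0)
    (hc : Monotone c) (hcpos : ∀ j, 1 ≤ j → 0 < c j) (N : ℕ) {t : ℝ} (ht : 0 < t) :
    P.real {ω | ∃ n ≤ N, 1 ≤ n ∧ 2 * t * c n < |∑ j ∈ Finset.Icc 1 n, d j ω|}
      ≤ (∑ j ∈ Finset.Icc 1 N, (c j ^ 2)⁻¹ * ∫ ω, d j ω ^ 2 ∂P) / t ^ 2 := by
  -- Kolmogorov's inequality is applied to the differences divided by `c j`; summation by parts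
  -- returns to the unweighted sums at the cost of the factor 2.
  have h := (hd.const_mul fun j => (c j)⁻¹).measure_exists_le N ht
  simp_rw [mul_pow, integral_const_mul, inv_pow] at h
  refine (measureReal_mono ?_).trans h
  rintro ω ⟨n, hn, -, hlt⟩
  by_contra hcon
  simp only [Set.mem_ofPred_eq, not_exists, not_and, not_le] at hcon
  have := abs_sum_le_of_weighted_sums_le hc0 hc hcpos (d := fun j => d j ω) n
    fun k hk => (hcon k (hk.trans hn)).le
  linarith

end IsBoundedMartingaleDiff

end Doob

/-! ### Independent sequences and conditional centring -/

section IID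

variable {Ω E : Type*} {m : MeasurableSpace Ω} [MeasurableSpace E] {P : Measure Ω}
  {μ : Measure E} {ξ : ℕ → Ω → E}

/-- `ξ` is a sequence of independent random variables with common law `μ`. -/
structure IsIIDSeq (ξ : ℕ → Ω → E) (μ : Measure E) (P : Measure Ω) : Prop where
  meas : ∀ i, Measurable (ξ i)
  indep : iIndepFun ξ P
  law : ∀ i, P.map (ξ i) = μ

/-- The vector `(ξ 1, …, ξ (j - 1))`. -/
def pastVec (ξ : ℕ → Ω → E) (j : ℕ) (ω : Ω) : Finset.Ico 1 j → E := fun i => ξ i ω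

theorem measurable_pastVec_of_le {mΩ : MeasurableSpace Ω} {j : ℕ}
    (hξ : ∀ i, 1 ≤ i → i < j → Measurable (ξ i)) : Measurable (pastVec ξ j) :=
  measurable_pi_lambda _ fun i => hξ i (Finset.mem_Ico.mp i.2).1 (Finset.mem_Ico.mp i.2).2

theorem measurable_pastVec (hξ : ∀ i, Measurable (ξ i)) (j : ℕ) : Measurable (pastVec ξ j) :=
  measurable_pi_lambda _ fun i => hξ i

/-- The filtration generated by `(ξ 1, …, ξ n)`. -/
def pastFiltration (ξ : ℕ → Ω → E) (hξ : ∀ i, Measurable (ξ i)) : Filtration ℕ m where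
  -- The shift is needed because `pastVec ξ j` stops at `ξ (j - 1)`.
  seq n := MeasurableSpace.comap (pastVec ξ (n + 1)) inferInstance
  mono' n k hnk := by
    rw [← measurable_iff_comap_le]
    exact measurable_pastVec_of_le fun i h1 h2 => (measurable_pi_apply (X := fun _ => E)
      (⟨i, Finset.mem_Ico.mpr ⟨h1, by omega⟩⟩ : Finset.Ico 1 (k + 1))).comp
      (comap_measurable (pastVec ξ (k + 1)))
  le' n := (measurable_pastVec hξ (n + 1)).comap_le

theorem measurable_pastFiltration (hξ : ∀ i, Measurable (ξ i)) {i n : ℕ} (h1 : 1 ≤ i)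
    (hi : i ≤ n) : Measurable[pastFiltration ξ hξ n] (ξ i) :=
  (measurable_pi_apply (X := fun _ => E)
      (⟨i, Finset.mem_Ico.mpr ⟨h1, by omega⟩⟩ : Finset.Ico 1 (n + 1))).comp
      (comap_measurable (pastVec ξ (n + 1)))

namespace IsIIDSeq

theorem isProbabilityMeasure [IsProbabilityMeasure P] (h : IsIIDSeq ξ μ P) :
    IsProbabilityMeasure μ := by
  rw [← h.law 0]
  exact Measure.isProbabilityMeasure_map (h.meas 0).aemeasurable

theorem map_pair [IsFiniteMeasure P] (h : IsIIDSeq ξ μ P) {i j : ℕ} (hij : i ≠ j) :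
    P.map (fun ω => (ξ i ω, ξ j ω)) = μ.prod μ := by
  rw [(h.indep.indepFun hij).map_prod_eq_prod_map_map (h.meas i).aemeasurable
    (h.meas j).aemeasurable, h.law, h.law]

theorem map_triple [IsFiniteMeasure P] (h : IsIIDSeq ξ μ P) {i j k : ℕ} (hij : i ≠ j)
    (hik : i ≠ k) (hjk : j ≠ k) :
    P.map (fun ω => ((ξ i ω, ξ j ω), ξ k ω)) = (μ.prod μ).prod μ := by
  rw [(h.indep.indepFun_prodMk h.meas i j k hik hjk).map_prod_eq_prod_map_map
    ((h.meas i).prodMk (h.meas j)).aemeasurable (h.meas k).aemeasurable, h.map_pair hij, h.law]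

/-- With this product law, conditioning on the past becomes Fubini: freeze the past vector and
integrate over `μ`. -/
theorem map_pastVec [IsFiniteMeasure P] (h : IsIIDSeq ξ μ P) (j : ℕ) :
    P.map (fun ω => (pastVec ξ j ω, ξ j ω)) = (P.map (pastVec ξ j)).prod μ := by
  have hd : Disjoint (Finset.Ico 1 j) {j} := by simp
  have h1 := h.indep.indepFun_finset _ _ hd h.meas
  have h2 : IndepFun (pastVec ξ j) (ξ j) P :=
    h1.comp measurable_id (measurable_pi_apply (⟨j, by simp⟩ : ({j} : Finset ℕ)))
  rw [h2.map_prod_eq_prod_map_map (measurable_pastVec h.meas j).aemeasurable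
    (h.meas j).aemeasurable, h.law]

section Centred

variable [IsProbabilityMeasure P] {f : (j : ℕ) → (Finset.Ico 1 j → E) → E → ℝ}

theorem measurable_condMean (h : IsIIDSeq ξ μ P)
    (hf : ∀ j, Measurable (Function.uncurry (f j))) (j : ℕ) :
    Measurable fun w => ∫ y, f j w y ∂μ := by
  have := h.isProbabilityMeasure
  exact (hf j).stronglyMeasurable.integral_prod_right.measurable

theorem abs_condMean_le (h : IsIIDSeq ξ μ P) {j : ℕ} {K : ℝ} (hK : ∀ w y, |f j w y| ≤ K)
    (w : Finset.Ico 1 j → E) : |∫ y, f j w y ∂μ| ≤ K := by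
  have := h.isProbabilityMeasure
  have := norm_integral_le_of_norm_le_const (μ := μ) (f := f j w) (ae_of_all _ fun y => hK w y)
  simpa using this

/-- Centring a function of the present given the past yields a martingale difference. -/
theorem isBoundedMartingaleDiff (h : IsIIDSeq ξ μ P)
    (hf : ∀ j, Measurable (Function.uncurry (f j))) (hb : ∀ j, ∃ K, ∀ w y, |f j w y| ≤ K) :
    IsBoundedMartingaleDiff (pastFiltration ξ h.meas) P
      (fun j ω => if 1 ≤ j then
        f j (pastVec ξ j ω) (ξ j ω) - ∫ y, f j (pastVec ξ j ω) y ∂μ else 0) := by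
  have := h.isProbabilityMeasure
  refine ⟨fun j => ?_, fun j => ?_, fun j Z hZ hZb => ?_⟩
  -- The value 0 at `j = 0` matters: the σ-algebra at time 0 is generated by an empty vector and
  -- does not see `ξ 0`.
  · split_ifs with hj
    · have hpast : Measurable[pastFiltration ξ h.meas j] (pastVec ξ j) :=
        measurable_pastVec_of_le fun i h1 h2 => measurable_pastFiltration h.meas h1 h2.le
      exact ((hf j).comp (hpast.prodMk (measurable_pastFiltration h.meas hj le_rfl))).sub
        ((h.measurable_condMean hf j).comp hpast)
    · exact measurable_const
  · obtain ⟨K, hK⟩ := hb j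
    refine ⟨K + K, fun ω => ?_⟩
    have hK0 : 0 ≤ K := (abs_nonneg _).trans (hK (pastVec ξ j ω) (ξ j ω))
    split_ifs
    · exact (abs_sub _ _).trans (add_le_add (hK _ _) (h.abs_condMean_le hK _))
    · simpa using hK0
  · have hne : Nonempty (Finset.Ico 1 (j + 1) → E) := by
      by_contra hcon
      rw [not_nonempty_iff] at hcon
      have : IsEmpty Ω := ⟨fun ω => hcon.elim (pastVec ξ (j + 1) ω)⟩
      exact IsProbabilityMeasure.ne_zero P (Measure.eq_zero_of_isEmpty P)
    -- Doob–Dynkin factorisation of `Z` through the past vector. The factor `z` is known to be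
    -- bounded only along the values of that vector, so integrability of `G` is checked on `Ω` and
    -- transported to the product law.
    obtain ⟨z, hz, hZz⟩ := hZ.exists_eq_measurable_comp
    obtain ⟨KZ, hKZ⟩ := hZb
    obtain ⟨K, hK⟩ := hb (j + 1)
    let G : (Finset.Ico 1 (j + 1) → E) × E → ℝ :=
      fun q => z q.1 * (f (j + 1) q.1 q.2 - ∫ y, f (j + 1) q.1 y ∂μ)
    have hG : Measurable G := (hz.comp measurable_fst).mul
      ((hf (j + 1)).sub ((h.measurable_condMean hf (j + 1)).comp measurable_fst))
    have hT : Measurable fun ω => (pastVec ξ (j + 1) ω, ξ (j + 1) ω) :=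
      (measurable_pastVec h.meas _).prodMk (h.meas _)
    have hGb : ∀ ω, |G (pastVec ξ (j + 1) ω, ξ (j + 1) ω)| ≤ KZ * (K + K) := fun ω => by
      have e : z (pastVec ξ (j + 1) ω) = Z ω := by rw [hZz]; rfl
      simp only [G, abs_mul, e]
      exact mul_le_mul (hKZ ω) ((abs_sub _ _).trans (add_le_add (hK _ _) (h.abs_condMean_le hK _)))
        (abs_nonneg _) ((abs_nonneg _).trans (hKZ ω))
    have hGi : Integrable G ((P.map (pastVec ξ (j + 1))).prod μ) := by
      rw [← h.map_pastVec, integrable_map_measure hG.aestronglyMeasurable hT.aemeasurable]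
      exact integrable_of_abs_le (hG.comp hT) hGb
    calc _ = ∫ ω, G (pastVec ξ (j + 1) ω, ξ (j + 1) ω) ∂P := by
          refine integral_congr_ae (ae_of_all _ fun ω => ?_)
          have e : z (pastVec ξ (j + 1) ω) = Z ω := by rw [hZz]; rfl
          simp [G, e]
      _ = ∫ q, G q ∂((P.map (pastVec ξ (j + 1))).prod μ) := by
          rw [← h.map_pastVec, integral_map hT.aemeasurable hG.aestronglyMeasurable]
      _ = 0 := by
          have : IsFiniteMeasure (P.map (pastVec ξ (j + 1))) := inferInstance
          rw [integral_prod _ hGi]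
          refine integral_eq_zero_of_ae (ae_of_all _ fun w => ?_)
          have hi : Integrable (fun y => f (j + 1) w y) μ :=
            integrable_of_abs_le ((hf (j + 1)).comp measurable_prodMk_left) (hK w)
          simp only [G, Pi.zero_apply]
          rw [integral_const_mul, integral_sub hi (integrable_const _)]
          simp

/-- For each frozen past, a variance is at most the second moment. -/
theorem integral_centred_sq_le (h : IsIIDSeq ξ μ P)
    (hf : ∀ j, Measurable (Function.uncurry (f j))) (hb : ∀ j, ∃ K, ∀ w y, |f j w y| ≤ K) (j : ℕ) :
    ∫ ω, (f j (pastVec ξ j ω) (ξ j ω) - ∫ y, f j (pastVec ξ j ω) y ∂μ) ^ 2 ∂P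
      ≤ ∫ ω, f j (pastVec ξ j ω) (ξ j ω) ^ 2 ∂P := by
  have := h.isProbabilityMeasure
  obtain ⟨K, hK⟩ := hb j
  have hT : Measurable fun ω => (pastVec ξ j ω, ξ j ω) :=
    (measurable_pastVec h.meas _).prodMk (h.meas _)
  have hg : Measurable fun q : (Finset.Ico 1 j → E) × E => f j q.1 q.2 := hf j
  have hF : Measurable fun q : (Finset.Ico 1 j → E) × E => ∫ y, f j q.1 y ∂μ :=
    (h.measurable_condMean hf j).comp measurable_fst
  have hG1 : Measurable fun q : (Finset.Ico 1 j → E) × E =>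
      (f j q.1 q.2 - ∫ y, f j q.1 y ∂μ) ^ 2 := (hg.sub hF).pow_const 2
  have hG2 : Measurable fun q : (Finset.Ico 1 j → E) × E => f j q.1 q.2 ^ 2 := hg.pow_const 2
  have hprob : IsFiniteMeasure (P.map (pastVec ξ j)) := inferInstance
  have hi1 : Integrable (fun q : (Finset.Ico 1 j → E) × E =>
      (f j q.1 q.2 - ∫ y, f j q.1 y ∂μ) ^ 2) ((P.map (pastVec ξ j)).prod μ) := by
    refine integrable_of_abs_le hG1 (K := (K + K) ^ 2) fun q => ?_
    rw [abs_pow]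
    exact pow_le_pow_left₀ (abs_nonneg _)
      ((abs_sub _ _).trans (add_le_add (hK _ _) (h.abs_condMean_le hK _))) 2
  have hi2 : Integrable (fun q : (Finset.Ico 1 j → E) × E =>
      f j q.1 q.2 ^ 2) ((P.map (pastVec ξ j)).prod μ) := by
    refine integrable_of_abs_le hG2 (K := K ^ 2) fun q => ?_
    rw [abs_pow]
    exact pow_le_pow_left₀ (abs_nonneg _) (hK _ _) 2
  rw [← integral_map (f := fun q : (Finset.Ico 1 j → E) × E =>
      (f j q.1 q.2 - ∫ y, f j q.1 y ∂μ) ^ 2) hT.aemeasurable hG1.aestronglyMeasurable,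
    ← integral_map (f := fun q : (Finset.Ico 1 j → E) × E => f j q.1 q.2 ^ 2)
      hT.aemeasurable hG2.aestronglyMeasurable, h.map_pastVec, integral_prod _ hi1,
    integral_prod _ hi2]
  refine integral_mono hi1.integral_prod_left hi2.integral_prod_left fun w => ?_
  have hm : Measurable fun y => f j w y := hg.comp measurable_prodMk_left
  have i1 : Integrable (fun y => f j w y) μ := integrable_of_abs_le hm (hK w)
  have i2 : Integrable (fun y => f j w y ^ 2) μ := by
    refine integrable_of_abs_le (hm.pow_const 2) (K := K ^ 2) fun q => ?_
    rw [abs_pow]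
    exact pow_le_pow_left₀ (abs_nonneg _) (hK _ _) 2
  set c := ∫ y, f j w y ∂μ with hc
  have i3 : Integrable (fun y => -2 * c * f j w y + c ^ 2) μ :=
    (i1.const_mul _).add (integrable_const _)
  have e : ∀ y, (f j w y - c) ^ 2 = f j w y ^ 2 + (-2 * c * f j w y + c ^ 2) := fun y => by ring
  show ∫ y, (f j w y - c) ^ 2 ∂μ ≤ ∫ y, f j w y ^ 2 ∂μ
  simp_rw [e]
  rw [integral_add i2 i3, integral_add (i1.const_mul _) (integrable_const _), integral_const_mul,
    ← hc]
  simp only [integral_const, probReal_univ, smul_eq_mul, one_mul]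
  nlinarith [sq_nonneg c]

/-- Maximal inequality for sums of centred functions of the present and the past. -/
theorem measure_exists_centred_le (h : IsIIDSeq ξ μ P)
    (hf : ∀ j, Measurable (Function.uncurry (f j))) (hb : ∀ j, ∃ K, ∀ w y, |f j w y| ≤ K)
    {c : ℕ → ℝ} (hc0 : 0 ≤ c 0) (hc : Monotone c) (hcpos : ∀ j, 1 ≤ j → 0 < c j) (N : ℕ)
    {t : ℝ} (ht : 0 < t) :
    P.real {ω | ∃ n ≤ N, 1 ≤ n ∧ 2 * t * c n < |∑ j ∈ Finset.Icc 1 n,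
        (f j (pastVec ξ j ω) (ξ j ω) - ∫ y, f j (pastVec ξ j ω) y ∂μ)|}
      ≤ (∑ j ∈ Finset.Icc 1 N, (c j ^ 2)⁻¹ * ∫ ω, f j (pastVec ξ j ω) (ξ j ω) ^ 2 ∂P) / t ^ 2 := by
  have h1 := (h.isBoundedMartingaleDiff hf hb).measure_exists_weighted_le hc0 hc hcpos N ht
  have e : ∀ n ω, ∑ j ∈ Finset.Icc 1 n, (if 1 ≤ j then
      f j (pastVec ξ j ω) (ξ j ω) - ∫ y, f j (pastVec ξ j ω) y ∂μ else 0)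
      = ∑ j ∈ Finset.Icc 1 n, (f j (pastVec ξ j ω) (ξ j ω) - ∫ y, f j (pastVec ξ j ω) y ∂μ) :=
    fun n ω => Finset.sum_congr rfl fun j hj => if_pos (Finset.mem_Icc.mp hj).1
  simp_rw [e] at h1
  refine h1.trans (div_le_div_of_nonneg_right (Finset.sum_le_sum fun j hj => ?_) (by positivity))
  simp only [(Finset.mem_Icc.mp hj).1, if_true]
  exact mul_le_mul_of_nonneg_left (h.integral_centred_sq_le hf hb j) (by positivity)

end Centred

/-- Second moment of a sum of a bounded kernel over the pairs with a fixed second index. -/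
theorem integral_sum_kernel_sq_le [IsProbabilityMeasure P] (h : IsIIDSeq ξ μ P) {k : E → E → ℝ}
    (hk : Measurable (Function.uncurry k)) {K : ℝ} (hK : ∀ x y, |k x y| ≤ K) (j : ℕ) :
    ∫ ω, (∑ i ∈ Finset.Ico 1 j, k (ξ i ω) (ξ j ω)) ^ 2 ∂P
      ≤ j * ∫ q, k q.1 q.2 ^ 2 ∂(μ.prod μ) + j ^ 2 * ∫ y, (∫ x, k x y ∂μ) ^ 2 ∂μ := by
  have := h.isProbabilityMeasure
  have hkm : Measurable fun q : E × E => k q.1 q.2 := hk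
  have hpair : ∀ i, Measurable fun ω => k (ξ i ω) (ξ j ω) :=
    fun i => hkm.comp ((h.meas i).prodMk (h.meas j))
  have hint : ∀ i i', Integrable (fun ω => k (ξ i ω) (ξ j ω) * k (ξ i' ω) (ξ j ω)) P := fun i i' =>
    IsBoundedMartingaleDiff.integrable_mul (hpair i) (hpair i') ⟨K, fun _ => hK _ _⟩
      ⟨K, fun _ => hK _ _⟩
  set D := ∫ q, k q.1 q.2 ^ 2 ∂(μ.prod μ) with hD
  set B := ∫ y, (∫ x, k x y ∂μ) ^ 2 ∂μ with hB
  have hD0 : 0 ≤ D := integral_nonneg fun _ => sq_nonneg _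
  have hB0 : 0 ≤ B := integral_nonneg fun _ => sq_nonneg _
  have hdiag : ∀ i ∈ Finset.Ico 1 j, ∫ ω, k (ξ i ω) (ξ j ω) * k (ξ i ω) (ξ j ω) ∂P = D := by
    intro i hi
    rw [hD, ← h.map_pair (Finset.mem_Ico.mp hi).2.ne,
      integral_map ((h.meas i).prodMk (h.meas j)).aemeasurable
        (hkm.pow_const 2).aestronglyMeasurable]
    simp [sq]
  -- Given `ξ j = y`, the two factors are independent with the same mean `∫ k x y dμ(x)`.
  have hoff : ∀ i ∈ Finset.Ico 1 j, ∀ i' ∈ Finset.Ico 1 j, i ≠ i' →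
      ∫ ω, k (ξ i ω) (ξ j ω) * k (ξ i' ω) (ξ j ω) ∂P = B := by
    intro i hi i' hi' hne
    have hg : Measurable fun q : (E × E) × E => k q.1.1 q.2 * k q.1.2 q.2 :=
      (hkm.comp (measurable_fst.fst.prodMk measurable_snd)).mul
        (hkm.comp (measurable_fst.snd.prodMk measurable_snd))
    have hgi : Integrable (fun q : (E × E) × E => k q.1.1 q.2 * k q.1.2 q.2)
        ((μ.prod μ).prod μ) := by
      refine integrable_of_abs_le hg (K := K * K) fun q => ?_
      rw [abs_mul]
      exact mul_le_mul (hK _ _) (hK _ _) (abs_nonneg _) ((abs_nonneg _).trans (hK q.1.1 q.2))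
    calc _ = ∫ q, k q.1.1 q.2 * k q.1.2 q.2 ∂((μ.prod μ).prod μ) := by
          rw [← h.map_triple hne (Finset.mem_Ico.mp hi).2.ne (Finset.mem_Ico.mp hi').2.ne,
            integral_map (((h.meas i).prodMk (h.meas i')).prodMk (h.meas j)).aemeasurable
              hg.aestronglyMeasurable]
      _ = B := by
          rw [integral_prod_symm _ hgi, hB]
          refine integral_congr_ae (ae_of_all _ fun y => ?_)
          simp only
          rw [integral_prod_mul (fun x => k x y) (fun x => k x y), sq]
  have hcard : ((Finset.Ico 1 j).card : ℝ) ≤ j := by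
    rw [Nat.card_Ico]; exact_mod_cast Nat.sub_le j 1
  calc _ = ∑ i ∈ Finset.Ico 1 j, ∑ i' ∈ Finset.Ico 1 j,
        ∫ ω, k (ξ i ω) (ξ j ω) * k (ξ i' ω) (ξ j ω) ∂P := by
        simp_rw [sq, Finset.sum_mul_sum]
        rw [integral_finsetSum _ fun i _ => integrable_finsetSum _ fun i' _ => hint i i']
        exact Finset.sum_congr rfl fun i _ => integral_finsetSum _ fun i' _ => hint i i'
    _ ≤ ∑ i ∈ Finset.Ico 1 j, ∑ i' ∈ Finset.Ico 1 j, ((if i = i' then D else 0) + B) := by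
        refine Finset.sum_le_sum fun i hi => Finset.sum_le_sum fun i' hi' => ?_
        split_ifs with heq
        · rw [← heq, hdiag i hi]; linarith
        · rw [hoff i hi i' hi' heq]; linarith
    _ = (Finset.Ico 1 j).card * D + (Finset.Ico 1 j).card ^ 2 * B := by
        simp only [Finset.sum_add_distrib, Finset.sum_const, nsmul_eq_mul, Finset.sum_ite_eq]
        congr 1
        · rw [← nsmul_eq_mul, ← Finset.sum_const]
          exact Finset.sum_congr rfl fun i hi => if_pos hi
        · ring
    _ ≤ _ := by gcongr

end IsIIDSeq

end IID

/-! ### The weak type inequality for i.i.d. sums -/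

section Linear

/-- This turns the deterministic series bounds, used pointwise with `u = |f x| ^ p` or `u` a section
moment, into moment bounds. -/
theorem sum_integral_le_of_sum_le {α : Type*} [MeasurableSpace α] {ν : Measure α} {s : Finset ℕ}
    {g : ℕ → α → ℝ} {v : α → ℝ} {C : ℝ} (hg : ∀ j ∈ s, Measurable (g j))
    (h0 : ∀ j ∈ s, ∀ x, 0 ≤ g j x) (hv : Integrable v ν) (hle : ∀ x, ∑ j ∈ s, g j x ≤ C * v x) :
    (∀ j ∈ s, Integrable (g j) ν) ∧ ∑ j ∈ s, ∫ x, g j x ∂ν ≤ C * ∫ x, v x ∂ν := by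
  have hint : ∀ j ∈ s, Integrable (g j) ν := fun j hj =>
    (hv.const_mul C).mono' (hg j hj).aestronglyMeasurable (ae_of_all _ fun x => by
      rw [Real.norm_eq_abs, abs_of_nonneg (h0 j hj x)]
      exact (Finset.single_le_sum (fun i hi => h0 i hi x) hj).trans (hle x))
  refine ⟨hint, ?_⟩
  rw [← integral_finsetSum _ hint, ← integral_const_mul]
  exact integral_mono (integrable_finsetSum _ hint) (hv.const_mul C) hle

theorem measureReal_preimage_eq_integral_ite {Ω α : Type*} {m : MeasurableSpace Ω}
    [MeasurableSpace α] {P : Measure Ω} {X : Ω → α} (hX : Measurable X) {S : α → Prop}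
    [DecidablePred S] (hS : MeasurableSet {x | S x}) :
    P.real {ω | S (X ω)} = ∫ x, (if S x then (1 : ℝ) else 0) ∂(P.map X) := by
  have h1 : (fun x => if S x then (1 : ℝ) else 0) = {x | S x}.indicator 1 := by
    ext x; simp [Set.indicator_apply]
  rw [h1, integral_indicator_one hS, map_measureReal_apply hX hS]
  rfl

theorem measureReal_exists_mem_le {Ω ι : Type*} {m : MeasurableSpace Ω} {P : Measure Ω}
    (s : Finset ι) (A : ι → Ω → Prop) :
    P.real {ω | ∃ j ∈ s, A j ω} ≤ ∑ j ∈ s, P.real {ω | A j ω} := by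
  have : {ω | ∃ j ∈ s, A j ω} = ⋃ j ∈ s, {ω | A j ω} := by ext; simp
  rw [this]
  exact measureReal_biUnion_finset_le _ _

/-- When `θ > 1/D` the bound is trivial, since a probability is at most `1 < D θ`; so `θ` may be
taken small. -/
theorem measureReal_le_of_threshold {Ω : Type*} {m : MeasurableSpace Ω} {P : Measure Ω}
    [IsProbabilityMeasure P] {A : Set Ω} {C D θ : ℝ} (hC : 0 ≤ C) (hD : 0 < D) (hθ : 0 ≤ θ)
    (h : θ ≤ 1 / D → P.real A ≤ C * θ) : P.real A ≤ (C + D) * θ := by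
  rcases le_or_gt θ (1 / D) with h1 | h1
  · refine (h h1).trans ?_
    nlinarith
  · rw [div_lt_iff₀ hD] at h1
    refine measureReal_le_one.trans ?_
    nlinarith

theorem abs_sq_eq_rpow {p : ℝ} (hp : 0 < p) (a : ℝ) : a ^ 2 = (|a| ^ p) ^ (2 * (1 / p)) := by
  rw [← Real.rpow_mul (abs_nonneg _), show p * (2 * (1 / p)) = 2 by field_simp, Real.rpow_two,
    sq_abs]

theorem abs_eq_rpow_rpow {p : ℝ} (hp : 0 < p) (a : ℝ) : |a| = (|a| ^ p) ^ (1 / p) := by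
  rw [← Real.rpow_mul (abs_nonneg _), mul_one_div_cancel hp.ne', Real.rpow_one]

theorem abs_le_rpow_of_rpow_le {p : ℝ} (hp : 0 < p) {a b : ℝ} (h : |a| ^ p ≤ b) :
    |a| ≤ b ^ (1 / p) := by
  rw [abs_eq_rpow_rpow hp a]
  exact Real.rpow_le_rpow (Real.rpow_nonneg (abs_nonneg _) _) h (by positivity)

theorem monotone_natCast_rpow {s : ℝ} (hs : 0 ≤ s) : Monotone fun n : ℕ => (n : ℝ) ^ s :=
  fun _ _ h => Real.rpow_le_rpow (Nat.cast_nonneg _) (by exact_mod_cast h) hs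

theorem integrable_of_integrable_abs_rpow {α : Type*} [MeasurableSpace α] {ν : Measure α}
    [IsFiniteMeasure ν] {f : α → ℝ} (hf : AEStronglyMeasurable f ν) {p : ℝ} (hp : 1 ≤ p)
    (hfp : Integrable (fun x => |f x| ^ p) ν) : Integrable f ν := by
  refine ((integrable_const (1 : ℝ)).add hfp).mono' hf (ae_of_all _ fun x => ?_)
  simp only [Pi.add_apply, Real.norm_eq_abs]
  rcases le_total |f x| 1 with h | h
  · have := Real.rpow_nonneg (abs_nonneg (f x)) p
    linarith
  · have := Real.self_le_rpow_of_one_le h hp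
    linarith

/-- The drift created by truncation in the linear case. -/
theorem exists_linear_drift_bound {p : ℝ} (hp1 : 1 ≤ p) : ∃ D : ℝ, 0 < D ∧
    ∀ {E : Type*} [MeasurableSpace E] (μ : Measure E) [IsProbabilityMeasure μ] (f : E → ℝ),
      Measurable f → Integrable (fun x => |f x| ^ p) μ → (p = 1 ∨ ∫ x, f x ∂μ = 0) →
      ∀ n : ℕ, |∑ j ∈ Finset.Icc 1 n, ∫ x, (if |f x| ^ p ≤ j then f x else 0) ∂μ|
        ≤ (n : ℝ) ^ (1 / p) * (D * ∫ x, |f x| ^ p ∂μ) := by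
  have hp0 : 0 < p := by linarith
  rcases hp1.eq_or_lt with rfl | hp1'
  -- For `p = 1` the normalisation is `n` itself, so `n` means each bounded by `∫ |f|` are
  -- affordable without centring.
  · refine ⟨1, one_pos, fun μ _ f hf hfp _ n => ?_⟩
    simp only [Real.rpow_one, div_one, one_mul] at hfp ⊢
    refine (Finset.abs_sum_le_sum_abs _ _).trans ?_
    have : ∀ j ∈ Finset.Icc 1 n, |∫ x, (if |f x| ≤ j then f x else 0) ∂μ| ≤ ∫ x, |f x| ∂μ := by
      intro j _
      refine (abs_integral_le_integral_abs).trans (integral_mono_of_nonneg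
        (ae_of_all _ fun x => abs_nonneg _) hfp (ae_of_all _ fun x => ?_))
      simp only
      split_ifs <;> simp
    simpa using Finset.sum_le_card_nsmul _ _ _ this
  · set r := 1 / p with hr
    have hr1 : r < 1 := by rw [hr, div_lt_one hp0]; exact hp1'
    have hr0 : 0 ≤ r := by positivity
    refine ⟨1 / (1 - r), by apply one_div_pos.mpr; linarith, fun μ _ f hf hfp hmean n => ?_⟩
    have hmean : ∫ x, f x ∂μ = 0 := hmean.resolve_left hp1'.ne'
    have hu : Measurable fun x => |f x| ^ p := hf.abs.pow_const p
    have hfi := integrable_of_integrable_abs_rpow hf.aestronglyMeasurable hp1'.le hfp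
    have hg : ∀ j : ℕ, Measurable fun x =>
        (if (j : ℝ) < |f x| ^ p then (j : ℝ) ^ (-r) * (|f x| ^ p) ^ r else 0) := fun j =>
      Measurable.ite (measurableSet_lt measurable_const hu)
        ((hu.pow_const r).const_mul _) measurable_const
    have hs := sum_integral_le_of_sum_le (s := Finset.Icc 1 n) (fun j _ => hg j)
      (fun j _ x => by split_ifs <;> positivity) hfp
      (fun x => sum_tail_first_moment_le hr0 hr1 (u := |f x| ^ p) (by positivity) n)
    refine (Finset.abs_sum_le_sum_abs _ _).trans ?_
    refine le_trans (Finset.sum_le_sum fun j hj => ?_)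
      ((Finset.mul_sum _ _ _).symm.le.trans (mul_le_mul_of_nonneg_left hs.2 (by positivity)))
    have hj1 : 1 ≤ j := (Finset.mem_Icc.mp hj).1
    have hj0 : (0 : ℝ) < j := by exact_mod_cast hj1
    have htr : Integrable (fun x => if |f x| ^ p ≤ (j : ℝ) then f x else 0) μ :=
      hfi.mono (Measurable.ite (measurableSet_le hu measurable_const) hf
        measurable_const).aestronglyMeasurable (ae_of_all _ fun x => by split_ifs <;> simp)
    -- As `f` has mean zero, the truncated mean is minus the mean of the discarded tail; the factor
    -- `n^r j^(-r) ≥ 1` then brings in the first-moment series.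
    have e1 : ∫ x, (if |f x| ^ p ≤ (j : ℝ) then f x else 0) ∂μ
        = ∫ x, ((if |f x| ^ p ≤ (j : ℝ) then f x else 0) - f x) ∂μ := by
      rw [integral_sub htr hfi, hmean, sub_zero]
    rw [e1, ← integral_const_mul]
    refine abs_integral_le_integral_abs.trans (integral_mono (htr.sub hfi).abs
      ((hs.1 j hj).const_mul _) fun x => ?_)
    simp only
    rcases le_or_gt (|f x| ^ p) (j : ℝ) with h | h
    · rw [if_pos h, if_neg (not_lt.mpr h)]; simp
    · rw [if_neg (not_le.mpr h), if_pos h, zero_sub, abs_neg, ← abs_eq_rpow_rpow hp0, ← mul_assoc]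
      refine le_mul_of_one_le_left (abs_nonneg _) ?_
      rw [Real.rpow_neg hj0.le, ← div_eq_mul_inv, one_le_div (by positivity)]
      exact Real.rpow_le_rpow hj0.le (by exact_mod_cast (Finset.mem_Icc.mp hj).2) hr0

/-- Weak type maximal inequality of Marcinkiewicz–Zygmund for i.i.d. sums. -/
theorem exists_linear_weak_type {p : ℝ} (hp1 : 1 ≤ p) (hp2 : p < 2) : ∃ C : ℝ, 0 ≤ C ∧
    ∀ {Ω : Type*} {E : Type*} {_ : MeasurableSpace Ω} [MeasurableSpace E] (P : Measure Ω)
      [IsProbabilityMeasure P] (μ : Measure E) (ξ : ℕ → Ω → E), IsIIDSeq ξ μ P →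
      ∀ f : E → ℝ, Measurable f → Integrable (fun x => |f x| ^ p) μ →
      (p = 1 ∨ ∫ x, f x ∂μ = 0) → ∀ N : ℕ,
      P.real {ω | ∃ n ≤ N, 1 ≤ n ∧ (n : ℝ) ^ (1 / p) < |∑ j ∈ Finset.Icc 1 n, f (ξ j ω)|}
        ≤ C * ∫ x, |f x| ^ p ∂μ := by
  obtain ⟨D, hD, hdrift⟩ := exists_linear_drift_bound hp1
  have hp0 : 0 < p := by linarith
  set r := 1 / p with hr
  have hr2 : 1 / 2 < r := one_div_lt_one_div_of_lt hp0 hp2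
  have hr0 : 0 < r := by linarith
  set C3 := (2 * r + 1) / (2 * r - 1) with hC3
  have hC3' : 0 ≤ C3 := div_nonneg (by linarith) (by linarith)
  -- 1 pays for the truncation event, `16 * C3` for the martingale at `t = 1/4`, and `2 * D` for
  -- assuming `D θ ≤ 1/2`, so that martingale and drift each use half of the level.
  refine ⟨(1 + 16 * C3) + 2 * D, by positivity, ?_⟩
  intro Ω E m _ P _ μ ξ h f hf hfp hmean N
  have := h.isProbabilityMeasure
  have hu : Measurable fun x => |f x| ^ p := hf.abs.pow_const p
  set θ := ∫ x, |f x| ^ p ∂μ with hθ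
  have hθ0 : 0 ≤ θ := integral_nonneg fun x => by positivity
  refine measureReal_le_of_threshold (by positivity) (by positivity) hθ0 fun hsmall => ?_
  let F : ℕ → E → ℝ := fun j x => if |f x| ^ p ≤ (j : ℝ) then f x else 0
  have hFm : ∀ j, Measurable (F j) := fun j =>
    Measurable.ite (measurableSet_le hu measurable_const) hf measurable_const
  have hFb : ∀ j x, |F j x| ≤ (j : ℝ) ^ r := fun j x => by
    simp only [F]
    split_ifs with hc
    · exact abs_le_rpow_of_rpow_le hp0 hc
    · simp only [abs_zero]; positivity
  have hbad1 : P.real {ω | ∃ j ∈ Finset.Icc 1 N, (j : ℝ) < |f (ξ j ω)| ^ p} ≤ θ := by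
    have hS : ∀ j : ℕ, MeasurableSet {x | (j : ℝ) < |f x| ^ p} :=
      fun j => measurableSet_lt measurable_const hu
    have hs := sum_integral_le_of_sum_le (s := Finset.Icc 1 N) (C := 1)
      (g := fun j x => if (j : ℝ) < |f x| ^ p then (1 : ℝ) else 0)
      (fun j _ => Measurable.ite (hS j) measurable_const measurable_const)
      (fun j _ x => by split_ifs <;> simp) hfp
      (fun x => by simpa using sum_indicator_lt_le (u := |f x| ^ p) (by positivity) N)
    refine (measureReal_exists_mem_le _ _).trans ?_
    refine le_trans (Finset.sum_le_sum fun j _ => ?_) (hs.2.trans (one_mul _).le)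
    rw [measureReal_preimage_eq_integral_ite (h.meas j) (S := fun x => (j : ℝ) < |f x| ^ p) (hS j),
      h.law]
  have hbad2 : P.real {ω | ∃ n ≤ N, 1 ≤ n ∧ 2 * (1 / 4) * (n : ℝ) ^ r
      < |∑ j ∈ Finset.Icc 1 n, (F j (ξ j ω) - ∫ y, F j y ∂μ)|} ≤ 16 * C3 * θ := by
    have hmart := h.measure_exists_centred_le (f := fun j _ y => F j y)
      (fun j => (hFm j).comp measurable_snd) (fun j => ⟨_, fun _ y => hFb j y⟩)
      (c := fun n => (n : ℝ) ^ r) (by positivity) (monotone_natCast_rpow hr0.le)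
      (fun j hj => Real.rpow_pos_of_pos (by exact_mod_cast hj) _) N (t := 1 / 4) (by norm_num)
    refine hmart.trans ?_
    have hs := sum_integral_le_of_sum_le (s := Finset.Icc 1 N)
      (g := fun j x => if |f x| ^ p ≤ (j : ℝ) then (j : ℝ) ^ (-(2 * r)) * (|f x| ^ p) ^ (2 * r)
        else 0)
      (fun j _ => Measurable.ite (measurableSet_le hu measurable_const)
        ((hu.pow_const _).const_mul _) measurable_const)
      (fun j _ x => by split_ifs <;> positivity) hfp
      (fun x => sum_truncated_sq_le hr2 (u := |f x| ^ p) (by positivity) N)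
    have e : ∀ j ∈ Finset.Icc 1 N, (((j : ℝ) ^ r) ^ 2)⁻¹ * ∫ ω, F j (ξ j ω) ^ 2 ∂P
        = ∫ x, (if |f x| ^ p ≤ (j : ℝ) then (j : ℝ) ^ (-(2 * r)) * (|f x| ^ p) ^ (2 * r)
          else 0) ∂μ := by
      intro j hj
      have hint : ∫ ω, F j (ξ j ω) ^ 2 ∂P = ∫ x, F j x ^ 2 ∂μ := by
        rw [← h.law j, integral_map (h.meas j).aemeasurable
          ((hFm j).pow_const 2).aestronglyMeasurable]
      rw [hint, ← integral_const_mul]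
      congr 1; ext x
      simp only [F]
      split_ifs
      · rw [← abs_sq_eq_rpow hp0, Real.rpow_neg (Nat.cast_nonneg _), mul_comm 2 r,
          Real.rpow_mul (Nat.cast_nonneg _), Real.rpow_two]
      · simp
    rw [Finset.sum_congr rfl e, div_le_iff₀ (by norm_num)]
    refine hs.2.trans (le_of_eq ?_)
    ring
  calc _ ≤ P.real ({ω | ∃ j ∈ Finset.Icc 1 N, (j : ℝ) < |f (ξ j ω)| ^ p} ∪
        {ω | ∃ n ≤ N, 1 ≤ n ∧ 2 * (1 / 4) * (n : ℝ) ^ r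
          < |∑ j ∈ Finset.Icc 1 n, (F j (ξ j ω) - ∫ y, F j y ∂μ)|}) := by
        refine measureReal_mono ?_
        rintro ω ⟨n, hnN, hn1, hlt⟩
        by_contra hcon
        rw [Set.mem_union, not_or] at hcon
        simp only [Set.mem_ofPred_eq, not_exists, not_and, not_lt] at hcon
        have h1 := hcon.2 n hnN hn1
        have h2 := hdrift μ f hf hfp hmean n
        have h3 : ∑ j ∈ Finset.Icc 1 n, f (ξ j ω) =
            ∑ j ∈ Finset.Icc 1 n, (F j (ξ j ω) - ∫ y, F j y ∂μ)
              + ∑ j ∈ Finset.Icc 1 n, ∫ x, (if |f x| ^ p ≤ (j : ℝ) then f x else 0) ∂μ := by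
          rw [← Finset.sum_add_distrib]
          refine Finset.sum_congr rfl fun j hj => ?_
          have := hcon.1 j (Finset.mem_Icc.mpr
            ⟨(Finset.mem_Icc.mp hj).1, (Finset.mem_Icc.mp hj).2.trans hnN⟩)
          simp [F, this]
        rw [h3] at hlt
        have h4 := abs_add_le (∑ j ∈ Finset.Icc 1 n, (F j (ξ j ω) - ∫ y, F j y ∂μ))
          (∑ j ∈ Finset.Icc 1 n, ∫ x, (if |f x| ^ p ≤ (j : ℝ) then f x else 0) ∂μ)
        have h5 : D * θ ≤ 1 / 2 := by
          rw [le_div_iff₀ (by positivity)] at hsmall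
          linarith
        have h6 : (n : ℝ) ^ r * (D * θ) ≤ (n : ℝ) ^ r * (1 / 2) :=
          mul_le_mul_of_nonneg_left h5 (by positivity)
        linarith
    _ ≤ _ := measureReal_union_le _ _
    _ ≤ θ + 16 * C3 * θ := add_le_add hbad1 hbad2
    _ = _ := by ring

end Linear

/-! ### Truncation of the kernel and its moment bounds -/

section Kernel

theorem integral_abs_rpow_le {α : Type*} [MeasurableSpace α] {ν : Measure α}
    [IsProbabilityMeasure ν] {f : α → ℝ} (hf : AEStronglyMeasurable f ν) {p : ℝ} (hp : 1 ≤ p)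
    (hfp : Integrable (fun x => |f x| ^ p) ν) : (∫ x, |f x| ∂ν) ^ p ≤ ∫ x, |f x| ^ p ∂ν :=
  (convexOn_rpow hp).map_integral_le (f := fun x => |f x|)
    (continuousOn_id.rpow_const fun _ _ => Or.inr (by linarith)) isClosed_Ici
    (ae_of_all _ fun x => abs_nonneg (f x))
    (integrable_of_integrable_abs_rpow hf hp hfp).abs hfp

theorem abs_integral_rpow_le {α : Type*} [MeasurableSpace α] {ν : Measure α}
    [IsProbabilityMeasure ν] {f : α → ℝ} (hf : AEStronglyMeasurable f ν) {p : ℝ} (hp : 1 ≤ p)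
    (hfp : Integrable (fun x => |f x| ^ p) ν) : |∫ x, f x ∂ν| ^ p ≤ ∫ x, |f x| ^ p ∂ν :=
  (Real.rpow_le_rpow (abs_nonneg _) abs_integral_le_integral_abs (by linarith)).trans
    (integral_abs_rpow_le hf hp hfp)

theorem integral_abs_le_rpow {α : Type*} [MeasurableSpace α] {ν : Measure α}
    [IsProbabilityMeasure ν] {f : α → ℝ} (hf : AEStronglyMeasurable f ν) {p : ℝ} (hp : 1 ≤ p)
    (hfp : Integrable (fun x => |f x| ^ p) ν) :
    ∫ x, |f x| ∂ν ≤ (∫ x, |f x| ^ p ∂ν) ^ (1 / p) := by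
  have h0 : 0 ≤ ∫ x, |f x| ∂ν := integral_nonneg fun x => abs_nonneg _
  have := abs_le_rpow_of_rpow_le (p := p) (by linarith) (a := ∫ x, |f x| ∂ν)
    (b := ∫ x, |f x| ^ p ∂ν)
    (by rw [abs_of_nonneg h0]; exact integral_abs_rpow_le hf hp hfp)
  rwa [abs_of_nonneg h0] at this

theorem measureReal_mono_of_ae_imp {Ω : Type*} {m : MeasurableSpace Ω} {P : Measure Ω}
    [IsFiniteMeasure P] {A B : Ω → Prop} (h : ∀ᵐ ω ∂P, A ω → B ω) :
    P.real {ω | A ω} ≤ P.real {ω | B ω} :=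
  ENNReal.toReal_mono (measure_ne_top _ _) (measure_mono_ae h)

variable {E : Type*} [MeasurableSpace E]

/-- The absolute moment of order `p` of the section `k (·, y)`. -/
noncomputable def sectionMoment (p : ℝ) (μ : Measure E) (k : E → E → ℝ) (y : E) : ℝ :=
  ∫ x, |k x y| ^ p ∂μ

/-- The kernel `k` truncated at `|k| ^ p ≤ j ^ 2` and where its section moment is at most `j`. -/
noncomputable def truncKernel (p : ℝ) (μ : Measure E) (k : E → E → ℝ) (j : ℕ) (x y : E) : ℝ :=
  if |k x y| ^ p ≤ (j : ℝ) ^ 2 ∧ sectionMoment p μ k y ≤ j then k x y else 0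

variable {p : ℝ} {μ : Measure E} {k : E → E → ℝ}

theorem sectionMoment_nonneg (y : E) : 0 ≤ sectionMoment p μ k y :=
  integral_nonneg fun x => by positivity

theorem measurable_sectionMoment [SFinite μ] (hk : Measurable (Function.uncurry k)) :
    Measurable (sectionMoment p μ k) := by
  have h1 : Measurable fun q : E × E => |k q.1 q.2| ^ p :=
    (show Measurable fun q : E × E => k q.1 q.2 from hk).abs.pow_const p
  exact h1.stronglyMeasurable.integral_prod_left.measurable

theorem integrable_sectionMoment [SFinite μ]
    (hkp : Integrable (fun q : E × E => |k q.1 q.2| ^ p) (μ.prod μ)) :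
    Integrable (sectionMoment p μ k) μ := hkp.integral_prod_right

theorem integral_sectionMoment [SFinite μ]
    (hkp : Integrable (fun q : E × E => |k q.1 q.2| ^ p) (μ.prod μ)) :
    ∫ y, sectionMoment p μ k y ∂μ = ∫ q, |k q.1 q.2| ^ p ∂(μ.prod μ) :=
  (integral_prod_symm _ hkp).symm

theorem measurable_truncKernel [SFinite μ] (hk : Measurable (Function.uncurry k)) (j : ℕ) :
    Measurable fun q : E × E => truncKernel p μ k j q.1 q.2 := by
  have h0 : Measurable fun q : E × E => k q.1 q.2 := hk
  exact Measurable.ite ((measurableSet_le (h0.abs.pow_const p) measurable_const).inter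
    (measurableSet_le ((measurable_sectionMoment hk).comp measurable_snd) measurable_const))
    h0 measurable_const

theorem abs_truncKernel_le (j : ℕ) (x y : E) : |truncKernel p μ k j x y| ≤ |k x y| := by
  unfold truncKernel; split_ifs <;> simp

theorem abs_truncKernel_le_rpow (hp : 0 < p) (j : ℕ) (x y : E) :
    |truncKernel p μ k j x y| ≤ ((j : ℝ) ^ 2) ^ (1 / p) := by
  unfold truncKernel
  split_ifs with hc
  · exact abs_le_rpow_of_rpow_le hp hc.1
  · rw [abs_zero]; positivity

theorem abs_truncKernel_sub_le (j : ℕ) (x y : E) : |truncKernel p μ k j x y - k x y|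
    ≤ (if (j : ℝ) ^ 2 < |k x y| ^ p then |k x y| else 0)
      + (if (j : ℝ) < sectionMoment p μ k y then |k x y| else 0) := by
  unfold truncKernel
  have := abs_nonneg (k x y)
  by_cases h1 : |k x y| ^ p ≤ (j : ℝ) ^ 2 <;> by_cases h2 : sectionMoment p μ k y ≤ j
  · simp [h1, h2, not_lt.mpr h1, not_lt.mpr h2]
  · simp [h1, h2, not_lt.mpr h1, not_le.mp h2]
  · simp [h1, h2, not_le.mp h1, not_lt.mpr h2]
  · simp [h1, h2, not_le.mp h1, not_le.mp h2]

variable [IsProbabilityMeasure μ]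

/-- Jensen's inequality on sections. It is claimed only almost everywhere: where the section is not
in `L^p`, `sectionMoment` takes the default value 0 of the integral. -/
theorem ae_integral_abs_section_le (hp : 1 ≤ p) (hk : Measurable (Function.uncurry k))
    (hkp : Integrable (fun q : E × E => |k q.1 q.2| ^ p) (μ.prod μ)) :
    ∀ᵐ y ∂μ, Integrable (fun x => k x y) μ ∧
      ∫ x, |k x y| ∂μ ≤ sectionMoment p μ k y ^ (1 / p) := by
  filter_upwards [hkp.prod_left_ae] with y hy
  have hm : Measurable fun x => k x y := hk.comp measurable_prodMk_right
  exact ⟨integrable_of_integrable_abs_rpow hm.aestronglyMeasurable hp hy,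
    integral_abs_le_rpow hm.aestronglyMeasurable hp hy⟩

/-- The second moments of the truncated kernels and of their sections. -/
theorem sum_second_moment_truncKernel_le (hp1 : 1 ≤ p) (hp2 : p < 2)
    (hk : Measurable (Function.uncurry k))
    (hkp : Integrable (fun q : E × E => |k q.1 q.2| ^ p) (μ.prod μ)) (N : ℕ) :
    ∑ j ∈ Finset.Icc 1 N, (((j : ℝ) ^ (1 + 1 / p)) ^ 2)⁻¹ *
        (j * ∫ q, truncKernel p μ k j q.1 q.2 ^ 2 ∂(μ.prod μ)
          + j ^ 2 * ∫ y, (∫ x, truncKernel p μ k j x y ∂μ) ^ 2 ∂μ)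
      ≤ ((2 * (1 / p) + 2) / (2 * (1 / p)) + (2 * (1 / p) + 1) / (2 * (1 / p) - 1))
        * ∫ q, |k q.1 q.2| ^ p ∂(μ.prod μ) := by
  have hp0 : 0 < p := by linarith
  set r := 1 / p with hr
  have hr2 : 1 / 2 < r := one_div_lt_one_div_of_lt hp0 hp2
  have hr1 : r ≤ 1 := by rw [hr, div_le_one hp0]; exact hp1
  have hk' : Measurable fun q : E × E => k q.1 q.2 := hk
  have hu : Measurable fun q : E × E => |k q.1 q.2| ^ p := hk'.abs.pow_const p
  have hB : Measurable (sectionMoment p μ k) := measurable_sectionMoment hk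
  have hs1 := sum_integral_le_of_sum_le (s := Finset.Icc 1 N)
    (g := fun j (q : E × E) => if |k q.1 q.2| ^ p ≤ (j : ℝ) ^ 2 then
      (j : ℝ) ^ (-(2 * r + 1)) * (|k q.1 q.2| ^ p) ^ (2 * r) else 0)
    (fun j _ => Measurable.ite (measurableSet_le hu measurable_const)
      ((hu.pow_const _).const_mul _) measurable_const)
    (fun j _ x => by split_ifs <;> positivity) hkp
    (fun q => sum_truncated_sq_le' hr2 hr1 (u := |k q.1 q.2| ^ p) (by positivity) N)
  have hs2 := sum_integral_le_of_sum_le (s := Finset.Icc 1 N)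
    (g := fun j y => if sectionMoment p μ k y ≤ (j : ℝ) then
      (j : ℝ) ^ (-(2 * r)) * (sectionMoment p μ k y) ^ (2 * r) else 0)
    (fun j _ => Measurable.ite (measurableSet_le hB measurable_const)
      ((hB.pow_const _).const_mul _) measurable_const)
    (fun j _ x => by
      have := sectionMoment_nonneg (p := p) (μ := μ) (k := k) x
      split_ifs <;> positivity) (integrable_sectionMoment hkp)
    (fun y => sum_truncated_sq_le hr2 (sectionMoment_nonneg y) N)
  rw [integral_sectionMoment hkp] at hs2
  rw [add_mul]
  refine le_trans ?_ (add_le_add hs1.2 hs2.2)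
  rw [← Finset.sum_add_distrib]
  refine Finset.sum_le_sum fun j hj => ?_
  have hj0 : (0 : ℝ) < j := by exact_mod_cast (Finset.mem_Icc.mp hj).1
  -- The squared weight leaves `j^(-(2r+1))` on the diagonal part, matching truncation at `j²`, and
  -- `j^(-2r)` on the section means, matching truncation of the section moment at `j`.
  have ec : (((j : ℝ) ^ (1 + r)) ^ 2)⁻¹ = (j : ℝ) ^ (-(2 + 2 * r)) := by
    rw [← Real.rpow_natCast, ← Real.rpow_mul hj0.le, ← Real.rpow_neg hj0.le]
    congr 1; push_cast; ring
  have ec1 : (((j : ℝ) ^ (1 + r)) ^ 2)⁻¹ * j = (j : ℝ) ^ (-(2 * r + 1)) := by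
    rw [ec]
    nth_rewrite 2 [← Real.rpow_one (j : ℝ)]
    rw [← Real.rpow_add hj0]
    congr 1; ring
  have ec2 : (((j : ℝ) ^ (1 + r)) ^ 2)⁻¹ * (j : ℝ) ^ 2 = (j : ℝ) ^ (-(2 * r)) := by
    rw [ec, ← Real.rpow_two, ← Real.rpow_add hj0]
    congr 1; ring
  rw [mul_add, ← mul_assoc, ← mul_assoc, ec1, ec2, ← integral_const_mul, ← integral_const_mul]
  refine add_le_add (integral_mono_of_nonneg (ae_of_all _ fun q => by positivity)
    (hs1.1 j hj) (ae_of_all _ fun q => ?_)) (integral_mono_of_nonneg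
    (ae_of_all _ fun q => by positivity) (hs2.1 j hj) ?_)
  · simp only [truncKernel]
    rw [← abs_sq_eq_rpow hp0]
    split_ifs with h1 h2 h2
    · exact le_rfl
    · exact absurd h1.1 h2
    · rw [zero_pow two_ne_zero, mul_zero]; positivity
    · simp
  · filter_upwards [ae_integral_abs_section_le hp1 hk hkp] with y hy
    split_ifs with h1
    · refine mul_le_mul_of_nonneg_left ?_ (by positivity)
      have h2 : |∫ x, truncKernel p μ k j x y ∂μ| ≤ sectionMoment p μ k y ^ r :=
        abs_integral_le_integral_abs.trans ((integral_mono_of_nonneg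
          (ae_of_all _ fun x => abs_nonneg _) hy.1.abs
          (ae_of_all _ fun x => abs_truncKernel_le j x y)).trans hy.2)
      rw [mul_comm 2 r, Real.rpow_mul (sectionMoment_nonneg y), Real.rpow_two, ← sq_abs]
      exact pow_le_pow_left₀ (abs_nonneg _) h2 2
    · simp [truncKernel, h1]

/-- The `L¹` error of truncation. -/
theorem sum_integral_abs_truncKernel_sub_le (hp1 : 1 < p)
    (hk : Measurable (Function.uncurry k))
    (hkp : Integrable (fun q : E × E => |k q.1 q.2| ^ p) (μ.prod μ)) (N : ℕ) :
    ∑ j ∈ Finset.Icc 1 N, (j : ℝ) ^ (-(1 / p)) *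
        ∫ q, |truncKernel p μ k j q.1 q.2 - k q.1 q.2| ∂(μ.prod μ)
      ≤ (1 / (1 - 1 / p) + 1 / (1 - 1 / p)) * ∫ q, |k q.1 q.2| ^ p ∂(μ.prod μ) := by
  have hp0 : 0 < p := by linarith
  set r := 1 / p with hr
  have hr0 : 0 ≤ r := by positivity
  have hr1 : r < 1 := by rw [hr, div_lt_one hp0]; exact hp1
  have hk' : Measurable fun q : E × E => k q.1 q.2 := hk
  have hu : Measurable fun q : E × E => |k q.1 q.2| ^ p := hk'.abs.pow_const p
  have hB : Measurable (sectionMoment p μ k) := measurable_sectionMoment hk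
  have hki : Integrable (fun q : E × E => k q.1 q.2) (μ.prod μ) :=
    integrable_of_integrable_abs_rpow hk'.aestronglyMeasurable hp1.le hkp
  have hs1 := sum_integral_le_of_sum_le (s := Finset.Icc 1 N)
    (g := fun j (q : E × E) => if (j : ℝ) ^ 2 < |k q.1 q.2| ^ p then
      (j : ℝ) ^ (-r) * (|k q.1 q.2| ^ p) ^ r else 0)
    (fun j _ => Measurable.ite (measurableSet_lt measurable_const hu)
      ((hu.pow_const _).const_mul _) measurable_const)
    (fun j _ x => by split_ifs <;> positivity) hkp
    (fun q => sum_tail_first_moment_le' hr0 hr1 (u := |k q.1 q.2| ^ p) (by positivity) N)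
  have hs2 := sum_integral_le_of_sum_le (s := Finset.Icc 1 N)
    (g := fun j y => if (j : ℝ) < sectionMoment p μ k y then
      (j : ℝ) ^ (-r) * (sectionMoment p μ k y) ^ r else 0)
    (fun j _ => Measurable.ite (measurableSet_lt measurable_const hB)
      ((hB.pow_const _).const_mul _) measurable_const)
    (fun j _ x => by
      have := sectionMoment_nonneg (p := p) (μ := μ) (k := k) x
      split_ifs <;> positivity) (integrable_sectionMoment hkp)
    (fun y => sum_tail_first_moment_le hr0 hr1 (sectionMoment_nonneg y) N)
  rw [integral_sectionMoment hkp] at hs2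
  rw [add_mul]
  refine le_trans ?_ (add_le_add hs1.2 hs2.2)
  rw [← Finset.sum_add_distrib]
  refine Finset.sum_le_sum fun j hj => ?_
  have i1 : Integrable (fun q : E × E => if (j : ℝ) ^ 2 < |k q.1 q.2| ^ p then |k q.1 q.2| else 0)
      (μ.prod μ) := hki.mono (Measurable.ite (measurableSet_lt measurable_const hu)
        hk'.abs measurable_const).aestronglyMeasurable
        (ae_of_all _ fun x => by split_ifs <;> simp)
  have i2 : Integrable (fun q : E × E =>
      if (j : ℝ) < sectionMoment p μ k q.2 then |k q.1 q.2| else 0) (μ.prod μ) :=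
    hki.mono (Measurable.ite (measurableSet_lt measurable_const (hB.comp measurable_snd))
      hk'.abs measurable_const).aestronglyMeasurable
      (ae_of_all _ fun x => by split_ifs <;> simp)
  have h1 : ∫ q, |truncKernel p μ k j q.1 q.2 - k q.1 q.2| ∂(μ.prod μ) ≤
      ∫ q, (if (j : ℝ) ^ 2 < |k q.1 q.2| ^ p then |k q.1 q.2| else 0) ∂(μ.prod μ)
      + ∫ q, (if (j : ℝ) < sectionMoment p μ k q.2 then |k q.1 q.2| else 0) ∂(μ.prod μ) := by
    rw [← integral_add i1 i2]
    exact integral_mono_of_nonneg (ae_of_all _ fun q => abs_nonneg _) (i1.add i2)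
      (ae_of_all _ fun q => abs_truncKernel_sub_le j q.1 q.2)
  refine (mul_le_mul_of_nonneg_left h1 (by positivity)).trans ?_
  rw [mul_add, ← integral_const_mul]
  refine add_le_add (le_of_eq ?_) ?_
  · congr 1; ext q
    rw [← abs_eq_rpow_rpow hp0]
    split_ifs <;> simp
  -- The second condition depends on `y` alone, so integrating over `x` first replaces `|k|` by at
  -- most the section moment to the power `r`.
  · rw [integral_prod_symm _ i2, ← integral_const_mul]
    refine integral_mono_of_nonneg (ae_of_all _ fun y => ?_) (hs2.1 j hj) ?_
    · exact mul_nonneg (by positivity) (integral_nonneg fun x => by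
        simp only
        split_ifs <;> positivity)
    · filter_upwards [ae_integral_abs_section_le hp1.le hk hkp] with y hy
      split_ifs with hc
      · exact mul_le_mul_of_nonneg_left hy.2 (by positivity)
      · simp

end Kernel

/-! ### The compensator and the finite-horizon weak type inequality -/

section WeakType

theorem ae_section_mean_bounds {E : Type*} [MeasurableSpace E] {μ : Measure E}
    [IsProbabilityMeasure μ] {k : E → E → ℝ} {p : ℝ} (hp1 : 1 ≤ p)
    (hk : Measurable (Function.uncurry k))
    (hkp : Integrable (fun q : E × E => |k q.1 q.2| ^ p) (μ.prod μ)) :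
    ∀ᵐ x ∂μ, ∀ j : ℕ, |∫ y, truncKernel p μ k j x y ∂μ| ≤ ∫ y, |k x y| ∂μ ∧
      |∫ y, truncKernel p μ k j x y ∂μ - ∫ y, k x y ∂μ|
        ≤ ∫ y, |truncKernel p μ k j x y - k x y| ∂μ := by
  filter_upwards [hkp.prod_right_ae] with x hx j
  have hm : Measurable fun y => k x y := hk.comp measurable_prodMk_left
  have hki : Integrable (fun y => k x y) μ :=
    integrable_of_integrable_abs_rpow hm.aestronglyMeasurable hp1 hx
  have hti : Integrable (fun y => truncKernel p μ k j x y) μ :=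
    hki.mono ((measurable_truncKernel hk j).comp measurable_prodMk_left).aestronglyMeasurable
      (ae_of_all _ fun y => abs_truncKernel_le j x y)
  refine ⟨abs_integral_le_integral_abs.trans (integral_mono hti.abs hki.abs
    fun y => abs_truncKernel_le j x y), ?_⟩
  rw [← integral_sub hti hki]
  exact abs_integral_le_integral_abs

theorem sum_range_drift_le {n : ℕ} {a : ℕ → ℝ} (ha : ∀ i, 0 ≤ a i) :
    ∑ j ∈ Finset.Icc 1 n, ∑ i ∈ Finset.Ico 1 j, a i ≤ n * ∑ i ∈ Finset.Icc 1 n, a i := by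
  have : ∀ j ∈ Finset.Icc 1 n, ∑ i ∈ Finset.Ico 1 j, a i ≤ ∑ i ∈ Finset.Icc 1 n, a i :=
    fun j hj => Finset.sum_le_sum_of_subset_of_nonneg (fun i hi => Finset.mem_Icc.mpr
      ⟨(Finset.mem_Ico.mp hi).1, by
        have := (Finset.mem_Ico.mp hi).2; have := (Finset.mem_Icc.mp hj).2; omega⟩)
      fun i _ _ => ha i
  simpa using Finset.sum_le_card_nsmul _ _ _ this

/-- The compensator of the truncated statistic is of weak type. -/
theorem exists_drift_weak_type {p : ℝ} (hp1 : 1 ≤ p) (hp2 : p < 2) : ∃ C : ℝ, 0 ≤ C ∧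
    ∀ {Ω : Type*} {E : Type*} {_ : MeasurableSpace Ω} [MeasurableSpace E] (P : Measure Ω)
      [IsProbabilityMeasure P] (μ : Measure E) (ξ : ℕ → Ω → E), IsIIDSeq ξ μ P →
      ∀ k : E → E → ℝ, Measurable (Function.uncurry k) →
      Integrable (fun q : E × E => |k q.1 q.2| ^ p) (μ.prod μ) →
      ∫ q, k q.1 q.2 ∂(μ.prod μ) = 0 → ∀ N : ℕ,
      P.real {ω | ∃ n ≤ N, 1 ≤ n ∧ 1 / 2 * (n : ℝ) ^ (1 + 1 / p) < |∑ j ∈ Finset.Icc 1 n,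
          ∑ i ∈ Finset.Ico 1 j, ∫ y, truncKernel p μ k j (ξ i ω) y ∂μ|}
        ≤ C * ∫ q, |k q.1 q.2| ^ p ∂(μ.prod μ) := by
  obtain ⟨C, hC, hlin⟩ := exists_linear_weak_type hp1 hp2
  have hp0 : 0 < p := by linarith
  rcases hp1.eq_or_lt with rfl | hp1'
  -- The compensator is at most `n` times a sum of the variables `∫ |k (ξ i) y| dμ(y)`. Doubling
  -- these before applying the linear inequality absorbs the level `1/2`.
  · refine ⟨C * 2, by positivity, ?_⟩
    intro Ω E _ _ P _ μ ξ h k hk hkp _ N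
    have := h.isProbabilityMeasure
    have hk' : Measurable fun q : E × E => k q.1 q.2 := hk
    have hkp' : Integrable (fun q : E × E => |k q.1 q.2|) (μ.prod μ) := by simpa using hkp
    have hA : Measurable fun x => ∫ y, |k x y| ∂μ :=
      hk'.abs.stronglyMeasurable.integral_prod_right.measurable
    have hA0 : ∀ x, 0 ≤ ∫ y, |k x y| ∂μ := fun x => integral_nonneg fun y => abs_nonneg _
    have hAi : Integrable (fun x => ∫ y, |k x y| ∂μ) μ := hkp'.integral_prod_left
    have hl := hlin P μ ξ h (fun x => 2 * ∫ y, |k x y| ∂μ) (hA.const_mul 2)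
      (by simpa using (hAi.const_mul 2).abs) (Or.inl rfl) N
    have e : ∫ x, |2 * ∫ y, |k x y| ∂μ| ^ (1 : ℝ) ∂μ
        = 2 * ∫ q, |k q.1 q.2| ^ (1 : ℝ) ∂(μ.prod μ) := by
      simp_rw [Real.rpow_one]
      rw [integral_prod _ hkp', ← integral_const_mul]
      congr 1; ext x
      exact abs_of_nonneg (mul_nonneg zero_le_two (hA0 x))
    rw [e] at hl
    rw [mul_assoc]
    refine le_trans (measureReal_mono_of_ae_imp ?_) hl
    have hae : ∀ᵐ ω ∂P, ∀ i, ∀ j : ℕ, |∫ y, truncKernel 1 μ k j (ξ i ω) y ∂μ|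
        ≤ ∫ y, |k (ξ i ω) y| ∂μ := ae_all_iff.mpr fun i => by
      have h1 := ae_section_mean_bounds le_rfl hk hkp
      rw [← h.law i] at h1
      have h2 := ae_of_ae_map (h.meas i).aemeasurable h1
      rw [h.law i] at h2
      exact h2.mono fun ω hω j => (hω j).1
    filter_upwards [hae] with ω hω
    rintro ⟨n, hnN, hn1, hlt⟩
    refine ⟨n, hnN, hn1, ?_⟩
    have hn0 : (0 : ℝ) < n := by exact_mod_cast hn1
    have h3 : |∑ j ∈ Finset.Icc 1 n, ∑ i ∈ Finset.Ico 1 j, ∫ y, truncKernel 1 μ k j (ξ i ω) y ∂μ|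
        ≤ n * ∑ i ∈ Finset.Icc 1 n, ∫ y, |k (ξ i ω) y| ∂μ :=
      (Finset.abs_sum_le_sum_abs _ _).trans ((Finset.sum_le_sum fun j _ =>
        (Finset.abs_sum_le_sum_abs _ _).trans (Finset.sum_le_sum fun i _ => hω i j)).trans
          (sum_range_drift_le fun i => hA0 _))
    have h4 := hlt.trans_le h3
    rw [show (1 : ℝ) + 1 / 1 = 2 by norm_num, Real.rpow_two] at h4
    rw [← Finset.mul_sum, div_one, Real.rpow_one]
    have h5 : (∑ j ∈ Finset.Icc 1 n, 2 * ∫ y, |k (ξ j ω) y| ∂μ)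
        = 2 * ∑ j ∈ Finset.Icc 1 n, ∫ y, |k (ξ j ω) y| ∂μ := (Finset.mul_sum _ _ _).symm
    have h6 := lt_of_mul_lt_mul_left (b := (n : ℝ) / 2)
      (c := ∑ i ∈ Finset.Icc 1 n, ∫ y, |k (ξ i ω) y| ∂μ)
      (by rwa [show (n : ℝ) * (n / 2) = 1 / 2 * (n : ℝ) ^ 2 by ring]) hn0.le
    rw [lt_abs]
    left
    linarith
  · set r := 1 / p with hr
    have hr0 : 0 < r := by positivity
    have hr1 : r < 1 := by rw [hr, div_lt_one hp0]; exact hp1'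
    set D := 1 / (1 - r) + 1 / (1 - r) with hD
    have hD0 : 0 ≤ D := by
      have : 0 ≤ 1 / (1 - r) := one_div_nonneg.mpr (by linarith)
      linarith
    -- The level `1/2` is split into two quarters: Markov's inequality for the replacement error
    -- gives `4 * D`, and the linear inequality for `4 a` gives `C * 4 ^ p`.
    refine ⟨4 * D + C * 4 ^ p, by positivity, ?_⟩
    intro Ω E _ _ P _ μ ξ h k hk hkp hmean N
    have := h.isProbabilityMeasure
    have hk' : Measurable fun q : E × E => k q.1 q.2 := hk
    have hki : Integrable (fun q : E × E => k q.1 q.2) (μ.prod μ) :=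
      integrable_of_integrable_abs_rpow hk'.aestronglyMeasurable hp1 hkp
    have hti : ∀ j, Integrable (fun q : E × E => truncKernel p μ k j q.1 q.2) (μ.prod μ) :=
      fun j => hki.mono (measurable_truncKernel hk j).aestronglyMeasurable
        (ae_of_all _ fun q => abs_truncKernel_le j q.1 q.2)
    set θ := ∫ q, |k q.1 q.2| ^ p ∂(μ.prod μ) with hθ
    let a : E → ℝ := fun x => ∫ y, k x y ∂μ
    let b : ℕ → E → ℝ := fun j x => ∫ y, truncKernel p μ k j x y ∂μ
    have ham : Measurable a := hk'.stronglyMeasurable.integral_prod_right.measurable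
    have hae := ae_section_mean_bounds hp1 hk hkp
    have hbad1 : P.real {ω | ∃ n ≤ N, 1 ≤ n ∧ (n : ℝ) ^ r < |∑ j ∈ Finset.Icc 1 n, 4 * a (ξ j ω)|}
        ≤ C * 4 ^ p * θ := by
      have hle : ∀ᵐ x ∂μ, |a x| ^ p ≤ ∫ y, |k x y| ^ p ∂μ := by
        filter_upwards [hkp.prod_right_ae] with x hx
        exact abs_integral_rpow_le (hk.comp measurable_prodMk_left).aestronglyMeasurable hp1 hx
      have hai : Integrable (fun x => |a x| ^ p) μ :=
        hkp.integral_prod_left.mono' (ham.abs.pow_const p).aestronglyMeasurable (by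
          filter_upwards [hle] with x hx
          rwa [Real.norm_eq_abs, abs_of_nonneg (by positivity)])
      have e : ∀ x, |4 * a x| ^ p = 4 ^ p * |a x| ^ p := fun x => by
        rw [abs_mul, Real.mul_rpow (abs_nonneg _) (abs_nonneg _), abs_of_pos (by norm_num)]
      have hl := hlin P μ ξ h (fun x => 4 * a x) (ham.const_mul 4)
        (by simp_rw [e]; exact hai.const_mul _)
        (Or.inr (by rw [integral_const_mul, ← integral_prod _ hki, hmean, mul_zero])) N
      refine hl.trans ?_
      simp_rw [e]
      rw [integral_const_mul, mul_assoc]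
      refine mul_le_mul_of_nonneg_left (mul_le_mul_of_nonneg_left ?_ (by positivity)) hC
      rw [hθ, integral_prod _ hkp]
      exact integral_mono_ae hai hkp.integral_prod_left hle
    -- A single integrable variable dominating the normalised replacement error for all `n ≤ N` at
    -- once, because `n^(1+r) ≥ j^(1+r)` for `j ≤ n`.
    let Y : Ω → ℝ := fun ω => ∑ j ∈ Finset.Icc 1 N, ((j : ℝ) ^ (1 + r))⁻¹ *
      ∑ i ∈ Finset.Ico 1 j, |b j (ξ i ω) - a (ξ i ω)|
    have hdi : ∀ j, Integrable (fun q : E × E => |truncKernel p μ k j q.1 q.2 - k q.1 q.2|)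
      (μ.prod μ) := fun j => ((hti j).sub hki).abs
    have hbai : ∀ j, Integrable (fun x => |b j x - a x|) μ := fun j =>
      ((hti j).integral_prod_left.sub hki.integral_prod_left).abs
    have hterm : ∀ i j, Integrable (fun ω => |b j (ξ i ω) - a (ξ i ω)|) P := fun i j => by
      have := hbai j
      rw [← h.law i] at this
      exact this.comp_measurable (h.meas i)
    have hYi : Integrable Y P := integrable_finsetSum _ fun j _ =>
      (integrable_finsetSum _ fun i _ => hterm i j).const_mul _
    have hEY : ∫ ω, Y ω ∂P ≤ D * θ := by
      have hYeq : ∫ ω, Y ω ∂P = ∑ j ∈ Finset.Icc 1 N,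
          ((j : ℝ) ^ (1 + r))⁻¹ * ∑ i ∈ Finset.Ico 1 j, ∫ x, |b j x - a x| ∂μ := by
        rw [integral_finsetSum _ fun j _ =>
          (integrable_finsetSum _ fun i _ => hterm i j).const_mul _]
        refine Finset.sum_congr rfl fun j _ => ?_
        rw [integral_const_mul, integral_finsetSum _ fun i _ => hterm i j]
        congr 1
        refine Finset.sum_congr rfl fun i _ => ?_
        rw [← h.law i, integral_map (h.meas i).aemeasurable
          (by rw [h.law i]; exact (hbai j).aestronglyMeasurable)]
      rw [hYeq]
      refine (Finset.sum_le_sum fun j hj => ?_).trans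
        (sum_integral_abs_truncKernel_sub_le hp1' hk hkp N)
      · have hj1 := (Finset.mem_Icc.mp hj).1
        have hj0 : (0 : ℝ) < j := by exact_mod_cast hj1
        have h1 : ∫ x, |b j x - a x| ∂μ
            ≤ ∫ q, |truncKernel p μ k j q.1 q.2 - k q.1 q.2| ∂(μ.prod μ) := by
          rw [integral_prod _ (hdi j)]
          exact integral_mono_ae (hbai j) (hdi j).integral_prod_left (hae.mono fun x hx => (hx j).2)
        have hcard : ((j - 1 : ℕ) : ℝ) ≤ j := by exact_mod_cast Nat.sub_le j 1
        rw [Finset.sum_const, Nat.card_Ico, nsmul_eq_mul]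
        calc _ ≤ ((j : ℝ) ^ (1 + r))⁻¹ * (j *
              ∫ q, |truncKernel p μ k j q.1 q.2 - k q.1 q.2| ∂(μ.prod μ)) := by
              refine mul_le_mul_of_nonneg_left ?_ (by positivity)
              exact mul_le_mul hcard h1 (integral_nonneg fun _ => abs_nonneg _) hj0.le
          _ = _ := by
              rw [← hr, ← mul_assoc, Real.rpow_add hj0, Real.rpow_one, Real.rpow_neg hj0.le]
              congr 1
              field_simp
    have hY0 : ∀ ω, 0 ≤ Y ω := fun ω => by positivity
    have hbad2 : P.real {ω | 1 / 4 ≤ Y ω} ≤ 4 * D * θ := by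
      have := mul_meas_ge_le_integral_of_nonneg (ae_of_all _ hY0) hYi (1 / 4)
      linarith
    refine le_trans (measureReal_mono ?_) ((measureReal_union_le _ _).trans
      ((add_le_add hbad2 hbad1).trans (by rw [add_mul])))
    rintro ω ⟨n, hnN, hn1, hlt⟩
    by_contra hcon
    rw [Set.mem_union, not_or] at hcon
    simp only [Set.mem_ofPred_eq, not_exists, not_and, not_lt, not_le] at hcon
    obtain ⟨hcY, hcS⟩ := hcon
    have hn0 : (0 : ℝ) < n := by exact_mod_cast hn1
    have hdecomp : ∑ j ∈ Finset.Icc 1 n, ∑ i ∈ Finset.Ico 1 j, b j (ξ i ω)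
        = ∑ j ∈ Finset.Icc 1 n, ∑ i ∈ Finset.Ico 1 j, (b j (ξ i ω) - a (ξ i ω))
          + ∑ j ∈ Finset.Icc 1 n, ∑ i ∈ Finset.Ico 1 j, a (ξ i ω) := by
      rw [← Finset.sum_add_distrib]
      refine Finset.sum_congr rfl fun j _ => ?_
      rw [← Finset.sum_add_distrib]
      simp
    have hI : |∑ j ∈ Finset.Icc 1 n, ∑ i ∈ Finset.Ico 1 j, (b j (ξ i ω) - a (ξ i ω))|
        ≤ (n : ℝ) ^ (1 + r) * Y ω := by
      refine (Finset.abs_sum_le_sum_abs _ _).trans ?_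
      have hsub : ∑ j ∈ Finset.Icc 1 n, ((j : ℝ) ^ (1 + r))⁻¹ *
          ∑ i ∈ Finset.Ico 1 j, |b j (ξ i ω) - a (ξ i ω)| ≤ Y ω :=
        Finset.sum_le_sum_of_subset_of_nonneg (Finset.Icc_subset_Icc_right hnN)
          fun j _ _ => by positivity
      refine le_trans ?_ (mul_le_mul_of_nonneg_left hsub (by positivity))
      rw [Finset.mul_sum]
      refine Finset.sum_le_sum fun j hj => (Finset.abs_sum_le_sum_abs _ _).trans ?_
      have hj0 : (0 : ℝ) < j := by exact_mod_cast (Finset.mem_Icc.mp hj).1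
      rw [← mul_assoc]
      refine le_mul_of_one_le_left (Finset.sum_nonneg fun _ _ => abs_nonneg _) ?_
      rw [← div_eq_mul_inv, one_le_div (by positivity)]
      exact monotone_natCast_rpow (by positivity) (Finset.mem_Icc.mp hj).2
    have hII : |∑ j ∈ Finset.Icc 1 n, ∑ i ∈ Finset.Ico 1 j, a (ξ i ω)|
        ≤ 1 / 4 * (n : ℝ) ^ (1 + r) := by
      refine (Finset.abs_sum_le_sum_abs _ _).trans ?_
      have : ∀ j ∈ Finset.Icc 1 n, |∑ i ∈ Finset.Ico 1 j, a (ξ i ω)| ≤ 1 / 4 * (n : ℝ) ^ r := by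
        intro j hj
        obtain ⟨hj1, hjn⟩ := Finset.mem_Icc.mp hj
        -- The inner sum is a partial sum of length `j - 1`; the empty case `j = 1` is separate
        -- because the linear bound starts at `n = 1`.
        rcases hj1.eq_or_lt with rfl | hj2
        · simp only [Finset.Ico_self, Finset.sum_empty, abs_zero]; positivity
        · have e : Finset.Ico 1 j = Finset.Icc 1 (j - 1) := by
            ext i; simp only [Finset.mem_Ico, Finset.mem_Icc]; omega
          have h1 := hcS (j - 1) (by omega) (by omega)
          rw [← Finset.mul_sum, abs_mul, abs_of_pos (by norm_num : (0 : ℝ) < 4)] at h1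
          have h2 := monotone_natCast_rpow hr0.le (show j - 1 ≤ n by omega)
          simp only at h2
          rw [e]
          linarith
      refine (Finset.sum_le_card_nsmul _ _ _ this).trans (le_of_eq ?_)
      rw [Nat.card_Icc, nsmul_eq_mul, Real.rpow_add hn0, Real.rpow_one]
      simp only [Nat.add_sub_cancel]
      ring
    have hlt' : 1 / 2 * (n : ℝ) ^ (1 + r) <
        |∑ j ∈ Finset.Icc 1 n, ∑ i ∈ Finset.Ico 1 j, b j (ξ i ω)| := hlt
    rw [hdecomp] at hlt'
    have := (hlt'.trans_le (abs_add_le _ _))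
    have h6 : (n : ℝ) ^ (1 + r) * Y ω ≤ (n : ℝ) ^ (1 + r) * (1 / 4) :=
      mul_le_mul_of_nonneg_left hcY.le (by positivity)
    linarith

/-- Weak type maximal inequality for centred statistics of order two, up to a finite horizon. -/
theorem exists_kernel_weak_type {p : ℝ} (hp1 : 1 ≤ p) (hp2 : p < 2) : ∃ C : ℝ, 0 ≤ C ∧
    ∀ {Ω : Type*} {E : Type*} {_ : MeasurableSpace Ω} [MeasurableSpace E] (P : Measure Ω)
      [IsProbabilityMeasure P] (μ : Measure E) (ξ : ℕ → Ω → E), IsIIDSeq ξ μ P →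
      ∀ k : E → E → ℝ, Measurable (Function.uncurry k) →
      Integrable (fun q : E × E => |k q.1 q.2| ^ p) (μ.prod μ) →
      ∫ q, k q.1 q.2 ∂(μ.prod μ) = 0 → ∀ N : ℕ,
      P.real {ω | ∃ n ≤ N, 1 ≤ n ∧ (n : ℝ) ^ (1 + 1 / p) < |∑ j ∈ Finset.Icc 1 n,
          ∑ i ∈ Finset.Ico 1 j, k (ξ i ω) (ξ j ω)|}
        ≤ C * ∫ q, |k q.1 q.2| ^ p ∂(μ.prod μ) := by
  obtain ⟨C, hC, hdrift⟩ := exists_drift_weak_type hp1 hp2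
  have hp0 : 0 < p := by linarith
  set r := 1 / p with hr
  have hr2 : 1 / 2 < r := one_div_lt_one_div_of_lt hp0 hp2
  have hr0 : 0 < r := by linarith
  set V := (2 * r + 2) / (2 * r) + (2 * r + 1) / (2 * r - 1) with hV
  have hV0 : 0 ≤ V :=
    add_nonneg (by positivity) (div_nonneg (by linarith) (by linarith))
  -- One unit for each of the two truncation conditions, `16 * V` for the martingale at `t = 1/4`,
  -- and `C` for the compensator; the last two each use half of the level.
  refine ⟨2 + 16 * V + C, by positivity, ?_⟩
  intro Ω E _ _ P _ μ ξ h k hk hkp hmean N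
  have := h.isProbabilityMeasure
  have hk' : Measurable fun q : E × E => k q.1 q.2 := hk
  have hu : Measurable fun q : E × E => |k q.1 q.2| ^ p := hk'.abs.pow_const p
  have hB : Measurable (sectionMoment p μ k) := measurable_sectionMoment hk
  set θ := ∫ q, |k q.1 q.2| ^ p ∂(μ.prod μ) with hθ
  let f : (j : ℕ) → (Finset.Ico 1 j → E) → E → ℝ :=
    fun j w y => ∑ i, truncKernel p μ k j (w i) y
  have hfm : ∀ j, Measurable (Function.uncurry (f j)) := fun j =>
    Finset.measurable_fun_sum _ fun i _ => by
      have hpr : Measurable fun a : (Finset.Ico 1 j → E) × E => (a.1 i, a.2) :=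
        ((measurable_pi_apply i).comp measurable_fst).prodMk measurable_snd
      exact (measurable_truncKernel hk j).comp hpr
  have hfb : ∀ j, ∃ K, ∀ w y, |f j w y| ≤ K := fun j =>
    ⟨∑ _i : Finset.Ico 1 j, ((j : ℝ) ^ 2) ^ (1 / p), fun w y =>
      (Finset.abs_sum_le_sum_abs _ _).trans
        (Finset.sum_le_sum fun i _ => abs_truncKernel_le_rpow hp0 j _ _)⟩
  have hfsum : ∀ j ω y, f j (pastVec ξ j ω) y
      = ∑ i ∈ Finset.Ico 1 j, truncKernel p μ k j (ξ i ω) y := fun j ω y =>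
    Finset.sum_coe_sort (Finset.Ico 1 j) fun i => truncKernel p μ k j (ξ i ω) y
  have hfmean : ∀ j ω, ∫ y, f j (pastVec ξ j ω) y ∂μ
      = ∑ i ∈ Finset.Ico 1 j, ∫ y, truncKernel p μ k j (ξ i ω) y ∂μ := fun j ω => by
    simp_rw [hfsum]
    exact integral_finsetSum _ fun i _ => integrable_of_abs_le
      ((measurable_truncKernel hk j).comp measurable_prodMk_left)
      (abs_truncKernel_le_rpow hp0 j (ξ i ω))
  have hbad1 : P.real {ω | ∃ j ∈ Finset.Icc 1 N, ∃ i ∈ Finset.Ico 1 j,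
      (j : ℝ) ^ 2 < |k (ξ i ω) (ξ j ω)| ^ p} ≤ θ := by
    have hS : ∀ j : ℕ, MeasurableSet {q : E × E | (j : ℝ) ^ 2 < |k q.1 q.2| ^ p} :=
      fun j => measurableSet_lt measurable_const hu
    have hs := sum_integral_le_of_sum_le (s := Finset.Icc 1 N) (C := 1)
      (g := fun j (q : E × E) => if (j : ℝ) ^ 2 < |k q.1 q.2| ^ p then (j : ℝ) else 0)
      (fun j _ => Measurable.ite (hS j) measurable_const measurable_const)
      (fun j _ x => by split_ifs <;> simp) hkp
      (fun q => by simpa using sum_mul_indicator_sq_lt_le (u := |k q.1 q.2| ^ p) (by positivity) N)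
    refine (measureReal_exists_mem_le _ _).trans ?_
    refine le_trans (Finset.sum_le_sum fun j _ => ?_) (hs.2.trans (one_mul _).le)
    refine (measureReal_exists_mem_le _ _).trans ?_
    have e : ∀ i ∈ Finset.Ico 1 j, P.real {ω | (j : ℝ) ^ 2 < |k (ξ i ω) (ξ j ω)| ^ p}
        ≤ ∫ q, (if (j : ℝ) ^ 2 < |k q.1 q.2| ^ p then (1 : ℝ) else 0) ∂(μ.prod μ) := by
      intro i hi
      rw [measureReal_preimage_eq_integral_ite (X := fun ω => (ξ i ω, ξ j ω))
        ((h.meas i).prodMk (h.meas j)) (S := fun q => (j : ℝ) ^ 2 < |k q.1 q.2| ^ p) (hS j),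
        h.map_pair (Finset.mem_Ico.mp hi).2.ne]
    refine (Finset.sum_le_card_nsmul _ _ _ e).trans ?_
    rw [Nat.card_Ico, nsmul_eq_mul]
    have e2 : ∫ q : E × E, (if (j : ℝ) ^ 2 < |k q.1 q.2| ^ p then (j : ℝ) else 0) ∂(μ.prod μ)
        = j * ∫ q : E × E, (if (j : ℝ) ^ 2 < |k q.1 q.2| ^ p then (1 : ℝ) else 0) ∂(μ.prod μ) := by
      rw [← integral_const_mul]
      congr 1; ext q; split_ifs <;> simp
    rw [e2]
    refine mul_le_mul_of_nonneg_right (by exact_mod_cast Nat.sub_le j 1)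
      (integral_nonneg fun q => ?_)
    simp only [Pi.zero_apply]
    split_ifs <;> simp
  have hbad2 : P.real {ω | ∃ j ∈ Finset.Icc 1 N, (j : ℝ) < sectionMoment p μ k (ξ j ω)} ≤ θ := by
    have hS : ∀ j : ℕ, MeasurableSet {y | (j : ℝ) < sectionMoment p μ k y} :=
      fun j => measurableSet_lt measurable_const hB
    have hs := sum_integral_le_of_sum_le (s := Finset.Icc 1 N) (C := 1)
      (g := fun j y => if (j : ℝ) < sectionMoment p μ k y then (1 : ℝ) else 0)
      (fun j _ => Measurable.ite (hS j) measurable_const measurable_const)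
      (fun j _ x => by split_ifs <;> simp) (integrable_sectionMoment hkp)
      (fun y => by simpa using sum_indicator_lt_le (sectionMoment_nonneg y) N)
    rw [integral_sectionMoment hkp] at hs
    refine (measureReal_exists_mem_le _ _).trans ?_
    refine le_trans (Finset.sum_le_sum fun j _ => ?_) (hs.2.trans (one_mul _).le)
    rw [measureReal_preimage_eq_integral_ite (h.meas j)
      (S := fun y => (j : ℝ) < sectionMoment p μ k y) (hS j), h.law]
  have hbad3 : P.real {ω | ∃ n ≤ N, 1 ≤ n ∧ 2 * (1 / 4) * (n : ℝ) ^ (1 + r) <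
      |∑ j ∈ Finset.Icc 1 n, (f j (pastVec ξ j ω) (ξ j ω) - ∫ y, f j (pastVec ξ j ω) y ∂μ)|}
      ≤ 16 * V * θ := by
    have hmart := h.measure_exists_centred_le hfm hfb
      (c := fun n => (n : ℝ) ^ (1 + r)) (by positivity) (monotone_natCast_rpow (by positivity))
      (fun j hj => Real.rpow_pos_of_pos (by exact_mod_cast hj) _) N (t := 1 / 4) (by norm_num)
    refine hmart.trans ?_
    rw [div_le_iff₀ (by norm_num)]
    refine le_trans (Finset.sum_le_sum fun j _ => mul_le_mul_of_nonneg_left ?_ (by positivity))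
      ((sum_second_moment_truncKernel_le hp1 hp2 hk hkp N).trans (le_of_eq (by ring)))
    simp_rw [hfsum]
    exact h.integral_sum_kernel_sq_le (k := truncKernel p μ k j) (measurable_truncKernel hk j)
      (abs_truncKernel_le_rpow hp0 j) j
  have hbad4 := hdrift P μ ξ h k hk hkp hmean N
  refine le_trans (measureReal_mono ?_) ((measureReal_union_le _ _).trans
    (add_le_add ((measureReal_union_le _ _).trans (add_le_add ((measureReal_union_le _ _).trans
      (add_le_add hbad1 hbad2)) hbad3)) hbad4) |>.trans (le_of_eq (by ring)))
  rintro ω ⟨n, hnN, hn1, hlt⟩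
  by_contra hcon
  simp only [Set.mem_union, not_or, Set.mem_ofPred_eq, not_exists, not_and, not_lt] at hcon
  obtain ⟨⟨⟨hc1, hc2⟩, hc3⟩, hc4⟩ := hcon
  have h3 := hc3 n hnN hn1
  have h4 := hc4 n hnN hn1
  -- Off the two truncation events the kernel agrees with its truncation at every pair involved, so
  -- the statistic is exactly martingale plus compensator.
  have e : ∑ j ∈ Finset.Icc 1 n, ∑ i ∈ Finset.Ico 1 j, k (ξ i ω) (ξ j ω)
      = ∑ j ∈ Finset.Icc 1 n,
          (f j (pastVec ξ j ω) (ξ j ω) - ∫ y, f j (pastVec ξ j ω) y ∂μ)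
        + ∑ j ∈ Finset.Icc 1 n, ∑ i ∈ Finset.Ico 1 j, ∫ y, truncKernel p μ k j (ξ i ω) y ∂μ := by
    rw [← Finset.sum_add_distrib]
    refine Finset.sum_congr rfl fun j hj => ?_
    have hjN : j ∈ Finset.Icc 1 N := Finset.Icc_subset_Icc_right hnN hj
    rw [hfmean, hfsum, sub_add_cancel]
    refine Finset.sum_congr rfl fun i hi => ?_
    rw [truncKernel, if_pos ⟨hc1 j hjN i hi, hc2 j hjN⟩]
  rw [e] at hlt
  have := hlt.trans_le (abs_add_le _ _)
  linarith

end WeakType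

/-! ### Infinite horizon and almost sure convergence -/

section Limit

variable {p : ℝ}

/-- Weak type maximal inequality for centred statistics of order two. -/
theorem exists_kernel_maximal_inequality (hp1 : 1 ≤ p) (hp2 : p < 2) : ∃ C : ℝ, 0 ≤ C ∧
    ∀ {Ω : Type*} {E : Type*} {_ : MeasurableSpace Ω} [MeasurableSpace E] (P : Measure Ω)
      [IsProbabilityMeasure P] (μ : Measure E) (ξ : ℕ → Ω → E), IsIIDSeq ξ μ P →
      ∀ k : E → E → ℝ, Measurable (Function.uncurry k) →
      Integrable (fun q : E × E => |k q.1 q.2| ^ p) (μ.prod μ) →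
      ∫ q, k q.1 q.2 ∂(μ.prod μ) = 0 → ∀ x : ℝ, 0 < x →
      x ^ p * P.real {ω | ∃ n : ℕ, 1 ≤ n ∧ x * (n : ℝ) ^ (1 + 1 / p) < |∑ j ∈ Finset.Icc 1 n,
          ∑ i ∈ Finset.Ico 1 j, k (ξ i ω) (ξ j ω)|}
        ≤ C * ∫ q, |k q.1 q.2| ^ p ∂(μ.prod μ) := by
  obtain ⟨C, hC, hw⟩ := exists_kernel_weak_type hp1 hp2
  refine ⟨C, hC, ?_⟩
  intro Ω E _ _ P _ μ ξ h k hk hkp hmean x hx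
  have hk' : Measurable fun q : E × E => k q.1 q.2 := hk
  have e : ∀ a : ℝ, |x⁻¹ * a| ^ p = (x ^ p)⁻¹ * |a| ^ p := fun a => by
    rw [abs_mul, abs_of_pos (inv_pos.mpr hx), Real.mul_rpow (by positivity) (abs_nonneg _),
      Real.inv_rpow hx.le]
  have hfin : ∀ N : ℕ, P.real {ω | ∃ n ≤ N, 1 ≤ n ∧ x * (n : ℝ) ^ (1 + 1 / p) <
      |∑ j ∈ Finset.Icc 1 n, ∑ i ∈ Finset.Ico 1 j, k (ξ i ω) (ξ j ω)|}
      ≤ C * ((x ^ p)⁻¹ * ∫ q, |k q.1 q.2| ^ p ∂(μ.prod μ)) := by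
    intro N
    have h1 := hw P μ ξ h (fun a b => x⁻¹ * k a b) (hk'.const_mul _)
      (by simp_rw [e]; exact hkp.const_mul _) (by rw [integral_const_mul, hmean, mul_zero]) N
    simp_rw [e] at h1
    rw [integral_const_mul] at h1
    refine le_trans (measureReal_mono ?_) h1
    rintro ω ⟨n, hnN, hn1, hlt⟩
    refine ⟨n, hnN, hn1, ?_⟩
    simp_rw [← Finset.mul_sum]
    rw [abs_mul, abs_of_pos (inv_pos.mpr hx), ← div_eq_inv_mul, lt_div_iff₀ hx, mul_comm]
    exact hlt
  -- The finite-horizon bound does not depend on `N`, so continuity from below along these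
  -- increasing events removes the horizon.
  let S : ℕ → Set Ω := fun N => {ω | ∃ n ≤ N, 1 ≤ n ∧ x * (n : ℝ) ^ (1 + 1 / p) <
      |∑ j ∈ Finset.Icc 1 n, ∑ i ∈ Finset.Ico 1 j, k (ξ i ω) (ξ j ω)|}
  have hmono : Monotone S := by
    rintro N M hNM ω ⟨n, hn, h2⟩
    exact ⟨n, hn.trans hNM, h2⟩
  have hU : {ω | ∃ n : ℕ, 1 ≤ n ∧ x * (n : ℝ) ^ (1 + 1 / p) < |∑ j ∈ Finset.Icc 1 n,
      ∑ i ∈ Finset.Ico 1 j, k (ξ i ω) (ξ j ω)|} = ⋃ N, S N := by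
    refine Set.ext fun ω => ⟨fun ⟨n, hn⟩ => Set.mem_iUnion.mpr ⟨n, n, le_rfl, hn⟩, fun hω => ?_⟩
    obtain ⟨_, n, _, hn⟩ := Set.mem_iUnion.mp hω
    exact ⟨n, hn⟩
  have hb : P.real (⋃ N, S N) ≤ C * ((x ^ p)⁻¹ * ∫ q, |k q.1 q.2| ^ p ∂(μ.prod μ)) := by
    refine ENNReal.toReal_le_of_le_ofReal (measureReal_nonneg.trans (hfin 0)) ?_
    rw [hmono.measure_iUnion]
    refine iSup_le fun N => ?_
    rw [← ofReal_measureReal]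
    exact ENNReal.ofReal_le_ofReal (hfin N)
  rw [hU]
  refine (mul_le_mul_of_nonneg_left hb (by positivity)).trans (le_of_eq ?_)
  have : x ^ p ≠ 0 := (Real.rpow_pos_of_pos hx p).ne'
  field_simp

variable {Ω E : Type*} {m : MeasurableSpace Ω} [MeasurableSpace E] {P : Measure Ω}
  [IsProbabilityMeasure P] {μ : Measure E} {ξ : ℕ → Ω → E} {k : E → E → ℝ}

/-- A bounded kernel has a finite moment of some order `s` strictly between `p` and 2. The maximal
inequality of order `s` makes the statistic almost surely `O(n^(1+1/s))`, and `1/s < 1/p`. -/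
theorem ae_tendsto_of_bounded_kernel (hp1 : 1 ≤ p) (hp2 : p < 2) (h : IsIIDSeq ξ μ P)
    (hk : Measurable (Function.uncurry k)) {K : ℝ} (hK : ∀ x y, |k x y| ≤ K)
    (hmean : ∫ q, k q.1 q.2 ∂(μ.prod μ) = 0) :
    ∀ᵐ ω ∂P, Tendsto (fun n : ℕ => (n : ℝ) ^ (-1 - 1 / p) *
      |∑ j ∈ Finset.Icc 1 n, ∑ i ∈ Finset.Ico 1 j, k (ξ i ω) (ξ j ω)|) atTop (𝓝 0) := by
  have := h.isProbabilityMeasure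
  set s := (p + 2) / 2 with hs
  have hs1 : 1 ≤ s := by rw [hs]; linarith
  have hs2 : s < 2 := by rw [hs]; linarith
  have hps : p < s := by rw [hs]; linarith
  have hp0 : 0 < p := by linarith
  have hs0 : 0 < s := by linarith
  have hexp : 1 / s < 1 / p := one_div_lt_one_div_of_lt hp0 hps
  have hk' : Measurable fun q : E × E => k q.1 q.2 := hk
  obtain ⟨C, hC, hmax⟩ := exists_kernel_maximal_inequality hs1 hs2
  have hks : Integrable (fun q : E × E => |k q.1 q.2| ^ s) (μ.prod μ) :=
    integrable_of_abs_le (hk'.abs.pow_const s) (K := K ^ s) fun q => by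
      rw [abs_of_nonneg (by positivity)]
      exact Real.rpow_le_rpow (abs_nonneg _) (hK _ _) hs0.le
  set θ := ∫ q, |k q.1 q.2| ^ s ∂(μ.prod μ) with hθ
  have hnull : P {ω | ∀ x : ℕ, ∃ n : ℕ, 1 ≤ n ∧ ((x : ℝ) + 1) * (n : ℝ) ^ (1 + 1 / s) <
      |∑ j ∈ Finset.Icc 1 n, ∑ i ∈ Finset.Ico 1 j, k (ξ i ω) (ξ j ω)|} = 0 := by
    rw [← measureReal_eq_zero_iff]
    refine le_antisymm ?_ measureReal_nonneg
    have hlim : Tendsto (fun x : ℕ => C * θ / ((x : ℝ) + 1) ^ s) atTop (𝓝 0) :=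
      tendsto_const_nhds.div_atTop ((tendsto_rpow_atTop hs0).comp
        (tendsto_atTop_add_const_right _ _ tendsto_natCast_atTop_atTop))
    refine ge_of_tendsto' hlim fun x => ?_
    have hx : (0 : ℝ) < (x : ℝ) + 1 := by positivity
    rw [le_div_iff₀ (by positivity), mul_comm]
    refine le_trans (mul_le_mul_of_nonneg_left (measureReal_mono ?_) (by positivity))
      (hmax P μ ξ h k hk hks hmean ((x : ℝ) + 1) hx)
    exact fun ω hω => hω x
  have hae : ∀ᵐ ω ∂P, ¬ ∀ x : ℕ, ∃ n : ℕ, 1 ≤ n ∧ ((x : ℝ) + 1) * (n : ℝ) ^ (1 + 1 / s) <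
      |∑ j ∈ Finset.Icc 1 n, ∑ i ∈ Finset.Ico 1 j, k (ξ i ω) (ξ j ω)| :=
    measure_eq_zero_iff_ae_notMem.mp hnull
  filter_upwards [hae] with ω hω
  simp only [not_forall, not_exists, not_and, not_lt] at hω
  obtain ⟨x, hx⟩ := hω
  have hlim : Tendsto (fun n : ℕ => ((x : ℝ) + 1) * (n : ℝ) ^ (-(1 / p - 1 / s))) atTop (𝓝 0) := by
    have := ((tendsto_rpow_neg_atTop (y := 1 / p - 1 / s) (by linarith)).comp
      tendsto_natCast_atTop_atTop).const_mul ((x : ℝ) + 1)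
    simpa using this
  refine squeeze_zero' (Eventually.of_forall fun n => by positivity) ?_ hlim
  filter_upwards [eventually_ge_atTop 1] with n hn
  have hn0 : (0 : ℝ) < n := by exact_mod_cast hn
  refine (mul_le_mul_of_nonneg_left (hx n hn) (by positivity)).trans (le_of_eq ?_)
  rw [mul_left_comm, ← Real.rpow_add hn0]
  congr 2; ring

/-- Bounded centred kernels approximate `k` in `L^p`: the recentring constants tend to `∫ k = 0`,
and dominated convergence does the rest. -/
theorem tendsto_integral_truncation_error [IsProbabilityMeasure μ] (hp1 : 1 ≤ p)
    (hk : Measurable (Function.uncurry k))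
    (hkp : Integrable (fun q : E × E => |k q.1 q.2| ^ p) (μ.prod μ))
    (hmean : ∫ q, k q.1 q.2 ∂(μ.prod μ) = 0) :
    Tendsto (fun K : ℕ => ∫ q, |k q.1 q.2 - ((if |k q.1 q.2| ≤ K then k q.1 q.2 else 0)
        - ∫ q', (if |k q'.1 q'.2| ≤ K then k q'.1 q'.2 else 0) ∂(μ.prod μ))| ^ p ∂(μ.prod μ))
      atTop (𝓝 0) := by
  have hp0 : 0 < p := by linarith
  have hk' : Measurable fun q : E × E => k q.1 q.2 := hk
  have hki : Integrable (fun q : E × E => k q.1 q.2) (μ.prod μ) :=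
    integrable_of_integrable_abs_rpow hk'.aestronglyMeasurable hp1 hkp
  let T : ℕ → E × E → ℝ := fun K q => if |k q.1 q.2| ≤ K then k q.1 q.2 else 0
  have hTm : ∀ K, Measurable (T K) := fun K =>
    Measurable.ite (measurableSet_le hk'.abs measurable_const) hk' measurable_const
  have hTle : ∀ K q, |T K q| ≤ |k q.1 q.2| := fun K q => by
    simp only [T]; split_ifs <;> simp
  have hTlim : ∀ q, Tendsto (fun K => T K q) atTop (𝓝 (k q.1 q.2)) := fun q => by
    obtain ⟨K0, hK0⟩ := exists_nat_ge |k q.1 q.2|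
    refine tendsto_const_nhds.congr' ?_
    filter_upwards [eventually_ge_atTop K0] with K hK
    have : |k q.1 q.2| ≤ K := hK0.trans (by exact_mod_cast hK)
    simp [T, this]
  have hmlim : Tendsto (fun K => ∫ q, T K q ∂(μ.prod μ)) atTop (𝓝 0) := by
    rw [← hmean]
    exact tendsto_integral_of_dominated_convergence (fun q => |k q.1 q.2|)
      (fun K => (hTm K).aestronglyMeasurable) hki.abs
      (fun K => ae_of_all _ fun q => hTle K q) (ae_of_all _ hTlim)
  have hmle : ∀ K, |∫ q, T K q ∂(μ.prod μ)| ≤ ∫ q, |k q.1 q.2| ∂(μ.prod μ) := fun K =>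
    abs_integral_le_integral_abs.trans (integral_mono_of_nonneg
      (ae_of_all _ fun q => abs_nonneg _) hki.abs (ae_of_all _ fun q => hTle K q))
  set b := ∫ q, |k q.1 q.2| ∂(μ.prod μ) with hb
  have hb0 : 0 ≤ b := integral_nonneg fun q => abs_nonneg _
  suffices H : Tendsto (fun K => ∫ q, |k q.1 q.2 - (T K q - ∫ q', T K q' ∂(μ.prod μ))| ^ p
      ∂(μ.prod μ)) atTop (𝓝 (∫ _q : E × E, (0 : ℝ) ∂(μ.prod μ))) by
    rwa [integral_zero] at H
  -- The dominating function comes from `(a + b)^p ≤ (2 max a b)^p ≤ 2^p a^p + 2^p b^p`.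
  refine tendsto_integral_of_dominated_convergence
    (fun q => 2 ^ p * |2 * k q.1 q.2| ^ p + 2 ^ p * b ^ p)
    (fun K => ((hk'.sub ((hTm K).sub_const _)).abs.pow_const p).aestronglyMeasurable) ?_
    (fun K => ae_of_all _ fun q => ?_) (ae_of_all _ fun q => ?_)
  · refine Integrable.add (Integrable.const_mul ?_ _) (integrable_const _)
    have e : ∀ q : E × E, |2 * k q.1 q.2| ^ p = 2 ^ p * |k q.1 q.2| ^ p := fun q => by
      rw [abs_mul, Real.mul_rpow (abs_nonneg _) (abs_nonneg _), abs_of_pos (by norm_num)]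
    simp_rw [e]
    exact hkp.const_mul _
  · rw [Real.norm_eq_abs, abs_of_nonneg (by positivity)]
    have h1 : |k q.1 q.2 - (T K q - ∫ q', T K q' ∂(μ.prod μ))| ≤ |2 * k q.1 q.2| + b := by
      have h2 := abs_sub (k q.1 q.2) (T K q - ∫ q', T K q' ∂(μ.prod μ))
      have h3 := abs_sub (T K q) (∫ q', T K q' ∂(μ.prod μ))
      rw [abs_mul, abs_of_pos (by norm_num : (0 : ℝ) < 2)]
      linarith [hTle K q, hmle K]
    refine (Real.rpow_le_rpow (abs_nonneg _) h1 hp0.le).trans ?_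
    rw [← mul_add]
    have ha := abs_nonneg (2 * k q.1 q.2)
    have hap : 0 ≤ |2 * k q.1 q.2| ^ p := by positivity
    have hbp : 0 ≤ b ^ p := by positivity
    rcases le_total (|2 * k q.1 q.2|) b with hc | hc
    · calc _ ≤ (2 * b) ^ p := Real.rpow_le_rpow (by positivity) (by linarith) hp0.le
        _ = 2 ^ p * b ^ p := Real.mul_rpow (by norm_num) hb0
        _ ≤ _ := mul_le_mul_of_nonneg_left (by linarith) (by positivity)
    · calc _ ≤ (2 * |2 * k q.1 q.2|) ^ p :=
            Real.rpow_le_rpow (by positivity) (by linarith) hp0.le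
        _ = 2 ^ p * |2 * k q.1 q.2| ^ p := Real.mul_rpow (by norm_num) ha
        _ ≤ _ := mul_le_mul_of_nonneg_left (by linarith) (by positivity)
  · have h1 : Tendsto (fun K => |k q.1 q.2 - (T K q - ∫ q', T K q' ∂(μ.prod μ))|) atTop
        (𝓝 |k q.1 q.2 - (k q.1 q.2 - 0)|) :=
      (tendsto_const_nhds.sub ((hTlim q).sub hmlim)).abs
    have h2 := h1.rpow_const (p := p) (Or.inr hp0.le)
    simpa [Real.zero_rpow hp0.ne'] using h2

/-- The strong law for statistics of order two with a centred kernel in `L^p`. -/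
theorem ae_tendsto_kernel (hp1 : 1 ≤ p) (hp2 : p < 2) (h : IsIIDSeq ξ μ P)
    (hk : Measurable (Function.uncurry k))
    (hkp : Integrable (fun q : E × E => |k q.1 q.2| ^ p) (μ.prod μ))
    (hmean : ∫ q, k q.1 q.2 ∂(μ.prod μ) = 0) :
    ∀ᵐ ω ∂P, Tendsto (fun n : ℕ => (n : ℝ) ^ (-1 - 1 / p) *
      |∑ j ∈ Finset.Icc 1 n, ∑ i ∈ Finset.Ico 1 j, k (ξ i ω) (ξ j ω)|) atTop (𝓝 0) := by
  have := h.isProbabilityMeasure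
  have hp0 : 0 < p := by linarith
  have hk' : Measurable fun q : E × E => k q.1 q.2 := hk
  have hki : Integrable (fun q : E × E => k q.1 q.2) (μ.prod μ) :=
    integrable_of_integrable_abs_rpow hk'.aestronglyMeasurable hp1 hkp
  obtain ⟨C, hC, hmax⟩ := exists_kernel_maximal_inequality hp1 hp2
  let c : ℕ → ℝ := fun K => ∫ q, (if |k q.1 q.2| ≤ K then k q.1 q.2 else 0) ∂(μ.prod μ)
  let g : ℕ → E → E → ℝ := fun K x y => (if |k x y| ≤ K then k x y else 0) - c K
  have hTm : ∀ K : ℕ, Measurable fun q : E × E => if |k q.1 q.2| ≤ K then k q.1 q.2 else 0 :=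
    fun K => Measurable.ite (measurableSet_le hk'.abs measurable_const) hk' measurable_const
  have hTb : ∀ (K : ℕ) x y, |if |k x y| ≤ K then k x y else 0| ≤ K := fun K x y => by
    split_ifs with hc
    · exact hc
    · simp
  have hTi : ∀ K : ℕ, Integrable (fun q : E × E => if |k q.1 q.2| ≤ K then k q.1 q.2 else 0)
      (μ.prod μ) := fun K => integrable_of_abs_le (hTm K) fun q => hTb K q.1 q.2
  have hgm : ∀ K, Measurable fun q : E × E => g K q.1 q.2 := fun K => (hTm K).sub_const _
  have hgi : ∀ K, Integrable (fun q : E × E => g K q.1 q.2) (μ.prod μ) := fun K =>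
    (hTi K).sub (integrable_const _)
  have hgmean : ∀ K, ∫ q, g K q.1 q.2 ∂(μ.prod μ) = 0 := fun K => by
    simp only [g]
    rw [integral_sub (hTi K) (integrable_const _)]
    simp [c]
  have hgb : ∀ K x y, |g K x y| ≤ K + |c K| := fun K x y =>
    (abs_sub _ _).trans (add_le_add (hTb K x y) le_rfl)
  have hglim : ∀ᵐ ω ∂P, ∀ K, Tendsto (fun n : ℕ => (n : ℝ) ^ (-1 - 1 / p) *
      |∑ j ∈ Finset.Icc 1 n, ∑ i ∈ Finset.Ico 1 j, g K (ξ i ω) (ξ j ω)|) atTop (𝓝 0) :=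
    ae_all_iff.mpr fun K => ae_tendsto_of_bounded_kernel hp1 hp2 h (hgm K) (hgb K) (hgmean K)
  have herr := tendsto_integral_truncation_error hp1 hk hkp hmean
  have herri : ∀ K, Integrable (fun q : E × E => |k q.1 q.2 - g K q.1 q.2| ^ p) (μ.prod μ) := by
    intro K
    have h1 : MemLp (fun q : E × E => k q.1 q.2) (ENNReal.ofReal p) (μ.prod μ) := by
      rw [← integrable_norm_rpow_iff hk'.aestronglyMeasurable (by simpa using hp0)
        ENNReal.ofReal_ne_top, ENNReal.toReal_ofReal hp0.le]
      exact hkp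
    have h2 : MemLp (fun q : E × E => g K q.1 q.2) (ENNReal.ofReal p) (μ.prod μ) :=
      MemLp.of_bound (hgm K).aestronglyMeasurable (K + |c K|) (ae_of_all _ fun q => hgb K q.1 q.2)
    have h3 := (h1.sub h2).integrable_norm_rpow (by simpa using hp0) ENNReal.ofReal_ne_top
    rw [ENNReal.toReal_ofReal hp0.le] at h3
    exact h3
  -- For fixed `δ = 1/(l+1)`, failure for every `K` has probability at most `C/δ^p` times the `L^p`
  -- error of each `K`, hence zero. The level `K` may depend on `ω`.
  have hnull : ∀ l : ℕ, ∀ᵐ ω ∂P, ∃ K : ℕ, ∀ n : ℕ, 1 ≤ n →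
      |∑ j ∈ Finset.Icc 1 n, ∑ i ∈ Finset.Ico 1 j, (k (ξ i ω) (ξ j ω) - g K (ξ i ω) (ξ j ω))|
        ≤ 1 / ((l : ℝ) + 1) * (n : ℝ) ^ (1 + 1 / p) := by
    intro l
    set δ := 1 / ((l : ℝ) + 1) with hδ
    have hδ0 : 0 < δ := by positivity
    have hz : P {ω | ∀ K : ℕ, ∃ n : ℕ, 1 ≤ n ∧ δ * (n : ℝ) ^ (1 + 1 / p) <
        |∑ j ∈ Finset.Icc 1 n, ∑ i ∈ Finset.Ico 1 j,
          (k (ξ i ω) (ξ j ω) - g K (ξ i ω) (ξ j ω))|} = 0 := by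
      rw [← measureReal_eq_zero_iff]
      refine le_antisymm ?_ measureReal_nonneg
      have hlim := (herr.const_mul C).div_const (δ ^ p)
      rw [mul_zero, zero_div] at hlim
      refine ge_of_tendsto' hlim fun K => ?_
      rw [le_div_iff₀ (by positivity), mul_comm]
      refine le_trans (mul_le_mul_of_nonneg_left (measureReal_mono ?_) (by positivity))
        (hmax P μ ξ h (fun x y => k x y - g K x y) (hk'.sub (hgm K)) (herri K)
          (by rw [integral_sub hki (hgi K), hmean, hgmean, sub_zero]) δ hδ0)
      exact fun ω hω => hω K
    have hae := measure_eq_zero_iff_ae_notMem.mp hz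
    filter_upwards [hae] with ω hω
    simpa only [Set.mem_ofPred_eq, not_forall, not_exists, not_and, not_lt, exists_prop] using hω
  filter_upwards [hglim, ae_all_iff.mpr hnull] with ω hg hn
  -- The form with strict `n > n0` ensures `n ≥ 1`, as the maximal bound requires.
  rw [Metric.tendsto_atTop']
  intro η hη
  obtain ⟨l, hl⟩ := exists_nat_one_div_lt (half_pos hη)
  obtain ⟨K, hK⟩ := hn l
  obtain ⟨n0, hn0⟩ := Metric.tendsto_atTop'.mp (hg K) (η / 2) (half_pos hη)
  refine ⟨n0, fun n hnn => ?_⟩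
  have h1 := hn0 n hnn
  have hpos : (0 : ℝ) < n := by exact_mod_cast (Nat.zero_le n0).trans_lt hnn
  have h2 := hK n (by omega)
  rw [Real.dist_0_eq_abs, abs_of_nonneg (by positivity)] at h1 ⊢
  have e : ∑ j ∈ Finset.Icc 1 n, ∑ i ∈ Finset.Ico 1 j, k (ξ i ω) (ξ j ω)
      = ∑ j ∈ Finset.Icc 1 n, ∑ i ∈ Finset.Ico 1 j, g K (ξ i ω) (ξ j ω)
        + ∑ j ∈ Finset.Icc 1 n, ∑ i ∈ Finset.Ico 1 j,
          (k (ξ i ω) (ξ j ω) - g K (ξ i ω) (ξ j ω)) := by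
    rw [← Finset.sum_add_distrib]
    refine Finset.sum_congr rfl fun j _ => ?_
    rw [← Finset.sum_add_distrib]
    simp
  have hr : (n : ℝ) ^ (-1 - 1 / p) * (1 / ((l : ℝ) + 1) * (n : ℝ) ^ (1 + 1 / p))
      = 1 / ((l : ℝ) + 1) := by
    rw [mul_left_comm, ← Real.rpow_add hpos, show -1 - 1 / p + (1 + 1 / p) = 0 by ring,
      Real.rpow_zero, mul_one]
  have h3 := mul_le_mul_of_nonneg_left h2 (by positivity : 0 ≤ (n : ℝ) ^ (-1 - 1 / p))
  rw [hr] at h3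
  have h4 : (n : ℝ) ^ (-1 - 1 / p) *
      |∑ j ∈ Finset.Icc 1 n, ∑ i ∈ Finset.Ico 1 j, k (ξ i ω) (ξ j ω)|
      ≤ (n : ℝ) ^ (-1 - 1 / p) *
        (|∑ j ∈ Finset.Icc 1 n, ∑ i ∈ Finset.Ico 1 j, g K (ξ i ω) (ξ j ω)|
          + |∑ j ∈ Finset.Icc 1 n, ∑ i ∈ Finset.Ico 1 j,
            (k (ξ i ω) (ξ j ω) - g K (ξ i ω) (ξ j ω))|) := by
    rw [e]
    exact mul_le_mul_of_nonneg_left (abs_add_le _ _) (by positivity)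
  rw [mul_add] at h4
  linarith

end Limit

/-! ### Transfer to the sequence indexed by the integers -/

theorem IsIID.isIIDSeq {Ω E : Type*} [MeasurableSpace Ω] [MeasurableSpace E] {P : Measure Ω}
    {ε : ℤ → Ω → E} (h : IsIID ε P) : IsIIDSeq (fun i : ℕ => ε i) (P.map (ε 0)) P where
  meas i := h.measurable i
  indep := h.indep.precomp Nat.cast_injective
  law i := (h.identDistrib i).map_eq

theorem mainTheorem7 (p : ℝ) (hp1 : 1 ≤ p) (hp2 : p < 2) :
    ∃ κ : ℝ, 1 < κ ∧
      ∀ (d : ℕ) (Ω : Type*) [MeasurableSpace Ω] (P : Measure Ω) [IsProbabilityMeasure P]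
        (ε : ℤ → Ω → EuclideanSpace ℝ (Fin d))
        (h : EuclideanSpace ℝ (Fin d) → EuclideanSpace ℝ (Fin d) → ℝ),
        IsIID ε P →
        Measurable (Function.uncurry h) →
        Integrable (fun ω => |h (ε 0 ω) (ε 1 ω)| ^ p) P →
        ∫ ω, h (ε 0 ω) (ε 1 ω) ∂P = 0 →
        (∀ᵐ ω ∂P, Tendsto (fun n : ℕ => (n : ℝ) ^ (-1 - 1 / p) * |UInd h ε n ω|)
            atTop (𝓝 0)) ∧
        (∀ x : ℝ, 0 < x →
          x ^ p * P.real {ω | ENNReal.ofReal x < maxUInd p h ε ω} ≤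
            κ * ∫ ω, |h (ε 0 ω) (ε 1 ω)| ^ p ∂P) := by
  obtain ⟨C, hC, hmax⟩ := exists_kernel_maximal_inequality hp1 hp2
  -- Only `C ≥ 0` is known; adding 2 secures `κ > 1`.
  refine ⟨C + 2, by linarith, ?_⟩
  intro d Ω _ P _ ε h hε hh hhp hmean
  have hiid := hε.isIIDSeq
  have hh' : Measurable fun q : EuclideanSpace ℝ (Fin d) × EuclideanSpace ℝ (Fin d) =>
    h q.1 q.2 := hh
  have hpair : P.map (fun ω => (ε 0 ω, ε 1 ω)) = (P.map (ε 0)).prod (P.map (ε 0)) := by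
    simpa using hiid.map_pair (i := 0) (j := 1) zero_ne_one
  have hT : Measurable fun ω => (ε 0 ω, ε 1 ω) := (hε.measurable 0).prodMk (hε.measurable 1)
  have hkp : Integrable (fun q : EuclideanSpace ℝ (Fin d) × EuclideanSpace ℝ (Fin d) =>
      |h q.1 q.2| ^ p) ((P.map (ε 0)).prod (P.map (ε 0))) := by
    rw [← hpair, integrable_map_measure (hh'.abs.pow_const p).aestronglyMeasurable hT.aemeasurable]
    exact hhp
  have hm0 : ∫ q, h q.1 q.2 ∂((P.map (ε 0)).prod (P.map (ε 0))) = 0 := by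
    rw [← hpair, integral_map hT.aemeasurable hh'.aestronglyMeasurable]
    exact hmean
  have hθ : ∫ q, |h q.1 q.2| ^ p ∂((P.map (ε 0)).prod (P.map (ε 0)))
      = ∫ ω, |h (ε 0 ω) (ε 1 ω)| ^ p ∂P := by
    rw [← hpair, integral_map hT.aemeasurable (hh'.abs.pow_const p).aestronglyMeasurable]
  refine ⟨ae_tendsto_kernel hp1 hp2 hiid hh hkp hm0, fun x hx => ?_⟩
  have h1 := hmax P _ _ hiid h hh hkp hm0 x hx
  rw [hθ] at h1
  have hθ0 : 0 ≤ ∫ ω, |h (ε 0 ω) (ε 1 ω)| ^ p ∂P := integral_nonneg fun ω => by positivity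
  refine le_trans (mul_le_mul_of_nonneg_left (measureReal_mono ?_) (by positivity))
    (h1.trans (by nlinarith))
  intro ω hω
  -- A supremum strictly above `x` has a term strictly above `x`, so no limiting argument in `x` is
  -- needed.
  simp only [Set.mem_ofPred_eq, maxUInd, lt_iSup_iff] at hω
  obtain ⟨n, hn, hlt⟩ := hω
  refine ⟨n, hn, ?_⟩
  have hn0 : (0 : ℝ) < (n : ℝ) ^ (1 + 1 / p) := Real.rpow_pos_of_pos (by exact_mod_cast hn) _
  have h2 := (ENNReal.ofReal_lt_ofReal_iff_of_nonneg hx.le).mp hlt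
  rw [one_div_mul_eq_div, lt_div_iff₀ hn0] at h2
  exact h2
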